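/- Graphs are finite, simple and connected. A cubic symmetric graph is a connected 3-valent graph $X$ whose automorphism group $\mathrm{Aut}(X)$ is transitive on arcs. An $s$-arc is a sequence $(u_0,\dots,u_s)$ of vertices with $u_i$ adjacent to $u_{i+1}$ for all $0\le i<s$ and $u_i\ne u_{i+2}$ for all $0\le i\le s-2$; a subgroup $G\le \mathrm{Aut}(X)$ is $s$-regular if it is transitive on $s$-arcs and the stabilizer in $G$ of each $s$-arc is trivial. An automorphism is odd if it is an odd permutation of the vertex set. For $m\ge 1$ and a finite group $K$ with $|K|\ge 2$, the graph $X$ is an $m$-Cayley graph on $K$ if $\mathrm{Aut}(X)$ has a subgroup isomorphic to $K$ that has exactly $m$ orbits on the vertices, all of length $|K|$, and acts regularly on each of them. Let $$\begin{aligned} G_1&=\langle h,a\mid h^3=a^2=1\rangle,\\ G_2^1&=\langle h,a,p\mid h^3=a^2=p^2=1,\ apa=p,\ php=h^{-1}\rangle,\\ G_2^2&=\langle h,a,p\mid h^3=p^2=1,\ a^2=p,\ php=h^{-1}\rangle,\\ G_3&=\langle h,a,p,q\mid h^3=a^2=p^2=q^2=1,\ apa=q,\ qp=pq,\ ph=hp,\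 qhq=h^{-1}\rangle,\\ G_4^1&=\langle h,a,p,q,r\mid h^3=a^2=p^2=q^2=r^2=1,\ apa=p,\ aqa=r,\ h^{-1}ph=q,\ h^{-1}qh=pq,\ rhr=h^{-1},\ pq=qp,\ pr=rp,\ rq=pqr\rangle,\\ G_4^2&=\langle h,a,p,q,r\mid h^3=p^2=q^2=r^2=1,\ a^2=p,\ a^{-1}qa=r,\ h^{-1}ph=q,\ h^{-1}qh=pq,\ rhr=h^{-1},\ pq=qp,\ pr=rp,\ rq=pqr\rangle,\\ G_5&=\langle h,a,p,q,r,s\mid h^3=a^2=p^2=q^2=r^2=s^2=1,\ apa=q,\ ara=s,\ h^{-1}ph=p,\ h^{-1}qh=r,\ h^{-1}rh=pqr,\\ &\qquad shs=h^{-1},\ pq=qp,\ pr=rp,\ ps=sp,\ qr=rq,\ qs=sq,\ sr=pqrs\rangle. \end{aligned}$$ A subgroup $H\le\mathrm{Aut}(X)$ is of class $1,2^1,2^2,3,4^1,4^2,5$, respectively, if it is $s$-regular, where $s$ is the number without the superscript, and there are an epimorphism $\varphi$ onto $H$ from the corresponding group in this list and a vertex $v$ of $X$ such that $\varphi$ maps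 the subgroup generated by all listed generators other than $a$ onto the stabilizer $H_v$, and $\varphi(a)$ takes $v$ to a neighbour of $v$ (so that $\varphi(a)$ reverses an edge at $v$). The graph $X$ is of type $\{1,2^1\}$ if $\mathrm{Aut}(X)$ itself is of class $1$ or $2^1$, and the classes that occur among the subgroups of $\mathrm{Aut}(X)$ are exactly $1$ and $2^1$. **Proposition.** Let $X$ be a cubic symmetric graph of order $2^km$, where $k\ge 2$ and $m\ge 1$ is odd, and let $G\le\mathrm{Aut}(X)$ be a $2$-regular subgroup that is an epimorphic image of $G_2^1$. Then $G$ contains an odd automorphism if and only if $X$ is non-bipartite, of type $\{1,2^1\}$, and an $m$-Cayley graph on a cyclic group of order $2^k$. -/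

import Mathlib

namespace CubicSym

section Graphs

variable {V : Type*}

/-- A cubic symmetric graph: connected, 3-valent, with automorphism group transitive on arcs. -/
structure IsCubicSymmetric (X : SimpleGraph V) : Prop where
  connected : X.Connected
  cubic : ∀ v : V, (X.neighborSet v).ncard = 3
  arcTransitive : ∀ u v u' v' : V, X.Adj u v → X.Adj u' v' →
    ∃ g : X ≃g X, g u = u' ∧ g v = v'

/-- `f 0, f 1, …, f s` is an `s`-arc: consecutive vertices are adjacent, and the sequence never
turns straight back. -/
def IsSArc (X : SimpleGraph V) (s : ℕ) (f : Fin (s + 1) → V) : Prop :=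
  (∀ i j : Fin (s + 1), (j : ℕ) = (i : ℕ) + 1 → X.Adj (f i) (f j)) ∧
    ∀ i j : Fin (s + 1), (j : ℕ) = (i : ℕ) + 2 → f i ≠ f j

/-- A group of automorphisms is `s`-regular: it is transitive on `s`-arcs, and the stabilizer in
it of an `s`-arc is trivial. -/
structure IsSRegular (X : SimpleGraph V) (s : ℕ) (G : Subgroup (X ≃g X)) : Prop where
  transitive : ∀ f f' : Fin (s + 1) → V, IsSArc X s f → IsSArc X s f' →
    ∃ g ∈ G, ∀ i, g (f i) = f' i
  stabilizer_trivial : ∀ f : Fin (s + 1) → V, IsSArc X s f →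
    ∀ g ∈ G, (∀ i, g (f i) = f i) → g = 1

/-- An odd automorphism: one that is an odd permutation of the vertex set. -/
def IsOddAut [Fintype V] [DecidableEq V] {X : SimpleGraph V} (g : X ≃g X) : Prop :=
  Equiv.Perm.sign (g.toEquiv : Equiv.Perm V) = -1

/-- A group of automorphisms is `(m, n)`-semiregular: it has exactly `m` orbits on vertices, all
of length `n`, and acts regularly on each of them. -/
structure IsSemiregularGroup (X : SimpleGraph V) (m n : ℕ) (H : Subgroup (X ≃g X)) : Prop where
  card_orbits : Nat.card (MulAction.orbitRel.Quotient H V) = m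
  orbit_length : ∀ v : V, (MulAction.orbit H v).ncard = n
  regular : ∀ v : V, MulAction.stabilizer H v = ⊥

/-- `X` is an `m`-Cayley graph on the finite group `K`. -/
def IsMCayley (X : SimpleGraph V) (m : ℕ) (K : Type*) [Group K] : Prop :=
  ∃ H : Subgroup (X ≃g X), IsSemiregularGroup X m (Nat.card K) H ∧ Nonempty (H ≃* K)

end Graphs

/-- The seven classes `1, 2¹, 2², 3, 4¹, 4², 5` of arc-transitive groups of automorphisms of
cubic graphs. -/
inductive ArcClass where
  | one | two1 | two2 | three | four1 | four2 | five

namespace ArcClass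

/-- Groups in the class are `s`-regular for this `s`. -/
def s : ArcClass → ℕ
  | one => 1
  | two1 => 2
  | two2 => 2
  | three => 3
  | four1 => 4
  | four2 => 4
  | five => 5

/-- The number of generators of the universal group of the class. -/
def rank : ArcClass → ℕ
  | one => 2
  | two1 => 3
  | two2 => 3
  | three => 4
  | four1 => 5
  | four2 => 5
  | five => 6

section Relators

variable {F : Type*} [Group F]

/-- `h³ = a² = 1` -/
def rel1 (h a : F) : Set F := {h ^ 3, a ^ 2}

/-- `h³ = a² = p² = 1, apa = p, php = h⁻¹` -/
def rel21 (h a p : F) : Set F :=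
  {h ^ 3, a ^ 2, p ^ 2, a * p * a * p⁻¹, p * h * p * (h⁻¹)⁻¹}

/-- `h³ = p² = 1, a² = p, php = h⁻¹` -/
def rel22 (h a p : F) : Set F :=
  {h ^ 3, p ^ 2, a ^ 2 * p⁻¹, p * h * p * (h⁻¹)⁻¹}

/-- `h³ = a² = p² = q² = 1, apa = q, qp = pq, ph = hp, qhq = h⁻¹` -/
def rel3 (h a p q : F) : Set F :=
  {h ^ 3, a ^ 2, p ^ 2, q ^ 2, a * p * a * q⁻¹, q * p * (p * q)⁻¹, p * h * (h * p)⁻¹,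
    q * h * q * (h⁻¹)⁻¹}

/-- `h³ = a² = p² = q² = r² = 1, apa = p, aqa = r, h⁻¹ph = q, h⁻¹qh = pq, rhr = h⁻¹, pq = qp,
pr = rp, rq = pqr` -/
def rel41 (h a p q r : F) : Set F :=
  {h ^ 3, a ^ 2, p ^ 2, q ^ 2, r ^ 2, a * p * a * p⁻¹, a * q * a * r⁻¹, h⁻¹ * p * h * q⁻¹,
    h⁻¹ * q * h * (p * q)⁻¹, r * h * r * (h⁻¹)⁻¹, p * q * (q * p)⁻¹, p * r * (r * p)⁻¹,
    r * q * (p * q * r)⁻¹}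

/-- `h³ = p² = q² = r² = 1, a² = p, a⁻¹qa = r, h⁻¹ph = q, h⁻¹qh = pq, rhr = h⁻¹, pq = qp,
pr = rp, rq = pqr` -/
def rel42 (h a p q r : F) : Set F :=
  {h ^ 3, p ^ 2, q ^ 2, r ^ 2, a ^ 2 * p⁻¹, a⁻¹ * q * a * r⁻¹, h⁻¹ * p * h * q⁻¹,
    h⁻¹ * q * h * (p * q)⁻¹, r * h * r * (h⁻¹)⁻¹, p * q * (q * p)⁻¹, p * r * (r * p)⁻¹,
    r * q * (p * q * r)⁻¹}

/-- `h³ = a² = p² = q² = r² = s² = 1, apa = q, ara = s, h⁻¹ph = p, h⁻¹qh = r, h⁻¹rh = pqr,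
shs = h⁻¹, pq = qp, pr = rp, ps = sp, qr = rq, qs = sq, sr = pqrs` -/
def rel5 (h a p q r s : F) : Set F :=
  {h ^ 3, a ^ 2, p ^ 2, q ^ 2, r ^ 2, s ^ 2, a * p * a * q⁻¹, a * r * a * s⁻¹,
    h⁻¹ * p * h * p⁻¹, h⁻¹ * q * h * r⁻¹, h⁻¹ * r * h * (p * q * r)⁻¹, s * h * s * (h⁻¹)⁻¹,
    p * q * (q * p)⁻¹, p * r * (r * p)⁻¹, p * s * (s * p)⁻¹, q * r * (r * q)⁻¹,
    q * s * (s * q)⁻¹, s * r * (p * q * r * s)⁻¹}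

end Relators

/-- Defining relators of the universal group of the class, as words in the generators
`h, a, p, q, r, s` (as many of them as there are), numbered in this order from `0`. -/
def relators : (c : ArcClass) → Set (FreeGroup (Fin c.rank))
  | one => rel1 (F := FreeGroup (Fin 2)) (.of 0) (.of 1)
  | two1 => rel21 (F := FreeGroup (Fin 3)) (.of 0) (.of 1) (.of 2)
  | two2 => rel22 (F := FreeGroup (Fin 3)) (.of 0) (.of 1) (.of 2)
  | three => rel3 (F := FreeGroup (Fin 4)) (.of 0) (.of 1) (.of 2) (.of 3)
  | four1 => rel41 (F := FreeGroup (Fin 5)) (.of 0) (.of 1) (.of 2) (.of 3) (.of 4)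
  | four2 => rel42 (F := FreeGroup (Fin 5)) (.of 0) (.of 1) (.of 2) (.of 3) (.of 4)
  | five => rel5 (F := FreeGroup (Fin 6)) (.of 0) (.of 1) (.of 2) (.of 3) (.of 4) (.of 5)

/-- The universal groups `G₁, G₂¹, G₂², G₃, G₄¹, G₄², G₅`. -/
abbrev UnivGroup (c : ArcClass) : Type := PresentedGroup c.relators

theorem one_lt_rank (c : ArcClass) : 1 < c.rank := by
  cases c <;> simp [rank]

/-- The generator `a`. -/
def genA (c : ArcClass) : c.UnivGroup := PresentedGroup.of ⟨1, c.one_lt_rank⟩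

/-- The subgroup generated by all the generators except `a`, that is `⟨h⟩`, `⟨h, p⟩`,
`⟨h, p, q⟩`, `⟨h, p, q, r⟩` or `⟨h, p, q, r, s⟩`. -/
def vertexGroup (c : ArcClass) : Subgroup c.UnivGroup :=
  Subgroup.closure {x | ∃ i : Fin c.rank, (i : ℕ) ≠ 1 ∧ PresentedGroup.of i = x}

end ArcClass

section Types

variable {V : Type*}

/-- The group `H` of automorphisms of `X` is of class `c`: it is `s`-regular for the `s` of the
class, and it is, with its action on `X`, a quotient of the universal group `⟨h, a, p, …⟩` of the
class. Here `⟨h, p, …⟩` is mapped onto the stabilizer of a vertex `v`, and `a` to an element that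
takes `v` to a neighbour (and reverses that edge, as `a²` lies in `⟨h, p, …⟩`). -/
def IsOfClass (X : SimpleGraph V) (H : Subgroup (X ≃g X)) (c : ArcClass) : Prop :=
  IsSRegular X c.s H ∧
    ∃ φ : c.UnivGroup →* H, Function.Surjective φ ∧
      ∃ v : V, c.vertexGroup.map φ = MulAction.stabilizer H v ∧ X.Adj v (φ c.genA • v)

/-- `X` is of type `T`: its full automorphism group belongs to a class in `T`, and `T` is the set
of the classes of all the arc-transitive groups of automorphisms of `X`. -/
structure IsOfType (X : SimpleGraph V) (T : Set ArcClass) : Prop where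
  aut : ∃ c ∈ T, IsOfClass X ⊤ c
  classes : ∀ c : ArcClass, c ∈ T ↔ ∃ H : Subgroup (X ≃g X), IsOfClass X H c

end Types

end CubicSym

/-! In a 2-regular group `G` the pointwise stabilizer of an arc has order two. Its involution, the
flip of the arc, is unique, and all flips are conjugate in `G`, so they share one sign. The
generators of `G₂¹` map to elements whose cube or square is 1. An involution without fixed vertices
is even because `4 ∣ |V|`, and one with a fixed vertex is a flip. Hence `G` has odd elements exactly
when its flips are odd.

Suppose the flips are odd. If `Aut(X)` were larger than `G`, it would be regular on `s`-arcs for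
some `s ≥ 3` (`exists_lineTrans_rigid`). Along the line swept out by a shunt there are then
conjugate involutions `x i`, each fixing `s` consecutive vertices. `false_of_odd` compares a flip
with them in the manner of Tutte: the `x i` must be odd, while the commutator of the first
non-commuting pair is even and fixes a long segment. Counting vertices leaves `s = 3`, refuted by
parity, and `s = 5`, refuted by squaring the flip. So `G = Aut(X)`. The even elements form a group
of class 1. Class 2² cannot occur, since there flips are squares.

The product of a flip and a suitable even edge reversal is an odd involution; in a bipartite graph
it would have no fixed vertex and be even.

For the cyclic group, an odd flip `p` has `2 mod 4` fixed vertices, so its centralizer in `G` has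
order `4 mod 8`. In a Sylow 2-subgroup, of order `2 ^ (k + 1)`, the centralizer of `p` therefore has
order at most 4, and an induction through central quotients gives an element of order `2 ^ k`. Its
involution is a square, hence even, hence no flip, so the cyclic group is semiregular.

Conversely, a generator of the cyclic group consists of `m` cycles of length `2 ^ k`, so it is odd,
and the type forces `G = Aut(X)`. -/

namespace CubicSym

/-! ### Cubic graphs, two-way infinite lines, and rigidity of arc-transitive actions -/

section Cubic

variable {V : Type*} {X : SimpleGraph V}

/-- Every vertex has exactly three neighbours. -/
def IsCubic (X : SimpleGraph V) : Prop := ∀ v : V, (X.neighborSet v).ncard = 3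

theorem aut_adj (g : X ≃g X) {u v : V} (h : X.Adj u v) : X.Adj (g u) (g v) :=
  g.map_rel_iff.2 h

@[simp] theorem aut_inv_apply_self (g : X ≃g X) (v : V) : g⁻¹ (g v) = v := g.symm_apply_apply v

@[simp] theorem aut_apply_inv_self (g : X ≃g X) (v : V) : g (g⁻¹ v) = v := g.apply_symm_apply v

theorem aut_mul_apply (g h : X ≃g X) (v : V) : (g * h) v = g (h v) := rfl

theorem aut_inv_fix {g : X ≃g X} {v : V} (h : g v = v) : g⁻¹ v = v := by
  conv_lhs => rw [← h]
  simp

theorem aut_ne {g : X ≃g X} {u v : V} (h : u ≠ v) : g u ≠ g v := fun e => h (g.injective e)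

theorem IsCubic.exists_neighbors (hc : IsCubic X) (v : V) : ∃ a b c, a ≠ b ∧ a ≠ c ∧ b ≠ c ∧
    ∀ x, X.Adj v x ↔ x = a ∨ x = b ∨ x = c := by
  obtain ⟨a, b, c, h1, h2, h3, h⟩ := Set.ncard_eq_three.1 (hc v)
  refine ⟨a, b, c, h1, h2, h3, fun x => ?_⟩
  rw [← SimpleGraph.mem_neighborSet, h]
  simp

theorem IsCubic.exists_neighbors_of_adj (hc : IsCubic X) {v a : V} (ha : X.Adj v a) :
    ∃ b c, a ≠ b ∧ a ≠ c ∧ b ≠ c ∧ ∀ x, X.Adj v x ↔ x = a ∨ x = b ∨ x = c := by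
  obtain ⟨x, y, z, h1, h2, h3, h⟩ := hc.exists_neighbors v
  rcases (h a).1 ha with rfl | rfl | rfl
  · exact ⟨y, z, h1, h2, h3, h⟩
  · exact ⟨x, z, h1.symm, h3, h2, fun t => by rw [h]; tauto⟩
  · exact ⟨x, y, h2.symm, h3.symm, h1, fun t => by rw [h]; tauto⟩

theorem IsCubic.exists_neighbors_of_two (hc : IsCubic X) {v a b : V} (ha : X.Adj v a)
    (hb : X.Adj v b) (hab : a ≠ b) :
    ∃ c, a ≠ c ∧ b ≠ c ∧ ∀ x, X.Adj v x ↔ x = a ∨ x = b ∨ x = c := by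
  obtain ⟨x, y, h1, h2, h3, h⟩ := hc.exists_neighbors_of_adj ha
  rcases (h b).1 hb with rfl | rfl | rfl
  · exact absurd rfl hab
  · exact ⟨y, h2, h3, h⟩
  · exact ⟨x, h1, h3.symm, fun t => by rw [h]; tauto⟩

theorem IsCubic.exists_ne (hc : IsCubic X) (u v : V) : ∃ w, X.Adj v w ∧ w ≠ u := by
  obtain ⟨a, b, c, h1, h2, h3, h⟩ := hc.exists_neighbors v
  by_cases hu : a = u
  · exact ⟨b, (h b).2 (by simp), fun e => h1 (hu.trans e.symm)⟩
  · exact ⟨a, (h a).2 (by simp), hu⟩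

theorem IsCubic.exists_ne_ne (hc : IsCubic X) (u u' v : V) : ∃ w, X.Adj v w ∧ w ≠ u ∧ w ≠ u' := by
  obtain ⟨a, b, c, h1, h2, h3, h⟩ := hc.exists_neighbors v
  have ha := (h a).2 (by simp)
  have hb := (h b).2 (by simp)
  have hc := (h c).2 (by simp)
  by_cases a1 : a = u
  · by_cases b1 : b = u'
    · exact ⟨c, hc, a1 ▸ h2.symm, b1 ▸ h3.symm⟩
    · exact ⟨b, hb, a1 ▸ h1.symm, b1⟩
  · by_cases a2 : a = u'
    · by_cases b1 : b = u
      · exact ⟨c, hc, b1 ▸ h3.symm, a2 ▸ h2.symm⟩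
      · exact ⟨b, hb, b1, a2 ▸ h1.symm⟩
    · exact ⟨a, ha, a1, a2⟩

/-- An automorphism fixing a vertex and two of its neighbours fixes the third one. -/
theorem IsCubic.fix_of_fix_two (hc : IsCubic X) {g : X ≃g X} {v a b c : V} (hv : g v = v)
    (ha : X.Adj v a) (hb : X.Adj v b) (hab : a ≠ b) (ga : g a = a) (gb : g b = b)
    (hvc : X.Adj v c) : g c = c := by
  obtain ⟨d, h1, h2, h⟩ := hc.exists_neighbors_of_two ha hb hab
  have h3 := aut_adj g hvc
  rw [hv] at h3
  rcases (h c).1 hvc with rfl | rfl | rfl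
  · exact ga
  · exact gb
  · rcases (h _).1 h3 with e | e | e
    · exact absurd (g.injective (e.trans ga.symm)) h1.symm
    · exact absurd (g.injective (e.trans gb.symm)) h2.symm
    · exact e

/-- Two automorphisms that fix a vertex and a neighbour, and both move a second neighbour, agree
on it. -/
theorem IsCubic.apply_eq_of_moves (hc : IsCubic X) {g g' : X ≃g X} {v a b : V} (hv : g v = v)
    (hv' : g' v = v) (ha : X.Adj v a) (hb : X.Adj v b) (ga : g a = a) (ga' : g' a = a)
    (gb : g b ≠ b) (gb' : g' b ≠ b) : g b = g' b := by
  have hab : a ≠ b := fun e => gb (e ▸ ga)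
  obtain ⟨d, h1, h2, h⟩ := hc.exists_neighbors_of_two ha hb hab
  have h3 := aut_adj g hb
  have h4 := aut_adj g' hb
  rw [hv] at h3
  rw [hv'] at h4
  have k1 : g b ≠ a := fun e => hab.symm (g.injective (e.trans ga.symm))
  have k2 : g' b ≠ a := fun e => hab.symm (g'.injective (e.trans ga'.symm))
  rcases (h _).1 h3 with e | e | e <;> rcases (h _).1 h4 with e' | e' | e' <;>
    first | contradiction | rw [e, e']

/-- Product form of `IsCubic.apply_eq_of_moves`. -/
theorem IsCubic.mul_fix_of_moves (hc : IsCubic X) {g g' : X ≃g X} {v a b : V} (hv : g v = v)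
    (hv' : g' v = v) (ha : X.Adj v a) (hb : X.Adj v b) (ga : g a = a) (ga' : g' a = a)
    (gb : g b ≠ b) (gb' : g' b ≠ b) : (g' * g) b = b := by
  have h := hc.apply_eq_of_moves hv (aut_inv_fix hv') ha hb ga (aut_inv_fix ga') gb
    (g' := g'⁻¹) (fun e => gb' (by simpa using (aut_inv_fix e)))
  rw [aut_mul_apply, h, aut_apply_inv_self]

/-- A two-way infinite walk that never turns straight back. -/
def IsLine (X : SimpleGraph V) (f : ℤ → V) : Prop :=
  ∀ i, X.Adj (f i) (f (i + 1)) ∧ f i ≠ f (i + 2)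

theorem IsLine.adj {f : ℤ → V} (hf : IsLine X f) (i : ℤ) : X.Adj (f i) (f (i + 1)) := (hf i).1

theorem IsLine.adj_of_eq {f : ℤ → V} (hf : IsLine X f) {i j : ℤ} (h : j = i + 1) :
    X.Adj (f i) (f j) := h ▸ (hf i).1

theorem IsLine.ne_of_eq {f : ℤ → V} (hf : IsLine X f) {i j : ℤ} (h : j = i + 2) :
    f i ≠ f j := h ▸ (hf i).2

theorem IsLine.shift {f : ℤ → V} (hf : IsLine X f) (k : ℤ) : IsLine X (fun i => f (i + k)) :=
  fun i => ⟨hf.adj_of_eq (by ring), hf.ne_of_eq (by ring)⟩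

theorem IsLine.reverse {f : ℤ → V} (hf : IsLine X f) (k : ℤ) : IsLine X (fun i => f (k - i)) :=
  fun i => ⟨(hf.adj_of_eq (by ring)).symm, (hf.ne_of_eq (by ring)).symm⟩

theorem IsLine.map {f : ℤ → V} (hf : IsLine X f) (g : X ≃g X) : IsLine X (fun i => g (f i)) :=
  fun i => ⟨aut_adj g (hf.adj i), aut_ne (hf i).2⟩

theorem IsCubic.exists_ray (hc : IsCubic X) {u v : V} (h : X.Adj u v) : ∃ r : ℕ → V, r 0 = u ∧
    r 1 = v ∧ ∀ i, X.Adj (r i) (r (i + 1)) ∧ r i ≠ r (i + 2) := by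
  choose nxt hn hn' using hc.exists_ne
  let step : V × V → V × V := fun p => (p.2, nxt p.1 p.2)
  have hs : ∀ n, step^[n + 1] (u, v) = step (step^[n] (u, v)) :=
    fun n => Function.iterate_succ_apply' step n _
  have hadj : ∀ n, X.Adj (step^[n] (u, v)).1 (step^[n] (u, v)).2 := by
    intro n
    induction n with
    | zero => exact h
    | succ n ih => rw [hs]; exact hn _ _
  refine ⟨fun n => (step^[n] (u, v)).1, rfl, rfl, fun i => ⟨?_, ?_⟩⟩
  · have := hadj i
    simpa only [hs] using this
  · have := (hn' (step^[i] (u, v)).1 (step^[i] (u, v)).2).symm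
    simpa only [hs] using this

/-- Glue a line on the nonpositive side to a new first step on the positive side. -/
theorem IsCubic.exists_line_turn (hc : IsCubic X) {r : ℕ → V}
    (hr : ∀ i, X.Adj (r i) (r (i + 1)) ∧ r i ≠ r (i + 2)) {w : V} (hw : X.Adj (r 0) w)
    (hne : w ≠ r 1) : ∃ f, IsLine X f ∧ (∀ n : ℕ, f (-n) = r n) ∧ f 1 = w := by
  obtain ⟨q, q0, q1, hq⟩ := hc.exists_ray hw
  let f : ℤ → V := fun i => if 0 ≤ i then q i.toNat else r (-i).toNat
  have fp : ∀ i : ℤ, 0 ≤ i → f i = q i.toNat := fun i h => if_pos h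
  have fn : ∀ i : ℤ, i ≤ 0 → f i = r (-i).toNat := by
    intro i h
    rcases h.lt_or_eq with h | rfl
    · exact if_neg (not_le.2 h)
    · simp [f, q0]
  refine ⟨f, fun i => ?_, fun n => ?_, ?_⟩
  · constructor
    · rcases le_or_gt 0 i with h | h
      · rw [fp i h, fp (i + 1) (by omega), show (i + 1).toNat = i.toNat + 1 by omega]
        exact (hq _).1
      · rw [fn i h.le, fn (i + 1) (by omega), show (-i).toNat = (-(i + 1)).toNat + 1 by omega]
        exact (hr _).1.symm
    · rcases le_or_gt 0 i with h | h
      · rw [fp i h, fp (i + 2) (by omega), show (i + 2).toNat = i.toNat + 2 by omega]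
        exact (hq _).2
      -- Only the 2-arc centred at the joint of the two rays needs `hne`.
      · rcases eq_or_ne i (-1) with rfl | h'
        · rw [fn _ h.le, fp _ (by norm_num)]
          change r 1 ≠ q 1
          rw [q1]
          exact hne.symm
        · rw [fn i h.le, fn (i + 2) (by omega), show (-i).toNat = (-(i + 2)).toNat + 2 by omega]
          exact (hr _).2.symm
  · rw [fn _ (by simp)]
    simp
  · rw [fp 1 (by norm_num)]
    exact q1

theorem IsCubic.exists_line (hc : IsCubic X) {u v w : V} (h : X.Adj u v) (h' : X.Adj v w)
    (hne : u ≠ w) : ∃ f, IsLine X f ∧ f 0 = u ∧ f 1 = v ∧ f 2 = w := by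
  obtain ⟨r, r0, r1, hr⟩ := hc.exists_ray h.symm
  obtain ⟨f, hf, h1, h2⟩ := hc.exists_line_turn hr (w := w) (r0 ▸ h') (r1 ▸ hne.symm)
  refine ⟨_, hf.shift (-1), ?_, ?_, ?_⟩
  · have := h1 1
    simpa [r1] using this
  · have := h1 0
    simpa [r0] using this
  · simpa using h2

theorem IsCubic.exists_line_modify (hc : IsCubic X) {f : ℤ → V} (hf : IsLine X f) (n : ℤ) {w : V}
    (hw : X.Adj (f n) w) (hne : w ≠ f (n - 1)) :
    ∃ f', IsLine X f' ∧ (∀ i, i ≤ n → f' i = f i) ∧ f' (n + 1) = w := by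
  obtain ⟨f', hf', h1, h2⟩ := hc.exists_line_turn (r := fun i : ℕ => f (n - i)) (w := w)
    (fun i => ⟨(hf.adj_of_eq (by push_cast; ring)).symm,
      (hf.ne_of_eq (by push_cast; ring)).symm⟩)
    (by simpa using hw) (by simpa using hne)
  refine ⟨_, hf'.shift (-n), fun i hi => ?_, ?_⟩
  · have := h1 (n - i).toNat
    simp only [Int.toNat_of_nonneg (sub_nonneg.2 hi)] at this
    rw [show i + -n = -(n - i) by ring, this]
    congr 1
    ring
  · simpa using h2

/-- `g` fixes `f i, …, f j`. -/
def FixSeg (f : ℤ → V) (i j : ℤ) (g : X ≃g X) : Prop := ∀ k, i ≤ k → k ≤ j → g (f k) = f k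

theorem FixSeg.mono {f : ℤ → V} {i j i' j' : ℤ} {g : X ≃g X} (h : FixSeg f i j g) (hi : i ≤ i')
    (hj : j' ≤ j) : FixSeg f i' j' g := fun k h1 h2 => h k (hi.trans h1) (h2.trans hj)

theorem FixSeg.mul {f : ℤ → V} {i j : ℤ} {g g' : X ≃g X} (h : FixSeg f i j g)
    (h' : FixSeg f i j g') : FixSeg f i j (g * g') :=
  fun k h1 h2 => by rw [aut_mul_apply, h' k h1 h2, h k h1 h2]

theorem FixSeg.inv {f : ℤ → V} {i j : ℤ} {g : X ≃g X} (h : FixSeg f i j g) :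
    FixSeg f i j g⁻¹ := fun k h1 h2 => aut_inv_fix (h k h1 h2)

theorem FixSeg.succ {f : ℤ → V} {i j : ℤ} {g : X ≃g X} (h : FixSeg f i j g)
    (h' : g (f (j + 1)) = f (j + 1)) : FixSeg f i (j + 1) g := by
  intro k h1 h2
  rcases h2.lt_or_eq with h2 | rfl
  · exact h k h1 (by omega)
  · exact h'

/-- The automorphism group is transitive on `s`-arcs, in terms of lines. -/
def LineTrans (X : SimpleGraph V) (s : ℕ) : Prop :=
  ∀ f f' : ℤ → V, IsLine X f → IsLine X f' →
    ∃ g : X ≃g X, ∀ i : ℤ, 0 ≤ i → i ≤ s → g (f i) = f' i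

/-- If the automorphism group is transitive on `s`-arcs but not on `(s + 1)`-arcs, then
the stabilizer of an `s`-arc is trivial. -/
theorem IsCubic.lineTrans_succ (hc : IsCubic X) (hconn : X.Connected) {s : ℕ} (hs : 1 ≤ s)
    (ht : LineTrans X s) {f : ℤ → V} (hf : IsLine X f) {x : X ≃g X} (hx : FixSeg f 0 s x)
    (hx1 : x ≠ 1) : LineTrans X (s + 1) := by
  by_contra hcon
  apply hx1
  -- the pointwise stabilizer of an `s`-arc fixes the next vertex
  have key : ∀ f : ℤ → V, IsLine X f → ∀ y : X ≃g X, FixSeg f 0 s y →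
      y (f (s + 1)) = f (s + 1) := by
    intro f₁ hf₁ y hy
    by_contra hne
    apply hcon
    intro f₂ f₃ hf₂ hf₃
    obtain ⟨g, hg⟩ := ht f₁ f₂ hf₁ hf₂
    obtain ⟨g', hg'⟩ := ht f₁ f₃ hf₁ hf₃
    -- `g` or `g * y` takes `f₁` to `f₂`
    have lem : ∀ (f' : ℤ → V) (g : X ≃g X), IsLine X f' →
        (∀ i : ℤ, 0 ≤ i → i ≤ s → g (f₁ i) = f' i) →
        ∃ z : X ≃g X, ∀ i : ℤ, 0 ≤ i → i ≤ s + 1 → z (f₁ i) = f' i := by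
      intro f' g hf' hg
      by_cases he : g (f₁ (s + 1)) = f' (s + 1)
      · refine ⟨g, fun i h0 h1 => ?_⟩
        rcases h1.lt_or_eq with h1 | rfl
        · exact hg i h0 (by omega)
        · exact he
      · refine ⟨g * y, fun i h0 h1 => ?_⟩
        rcases h1.lt_or_eq with h1 | rfl
        · rw [aut_mul_apply, hy i h0 (by omega), hg i h0 (by omega)]
        -- `g` and `g * y` send `f₁ (s + 1)` to two different neighbours of `f' s`, neither of them
        -- `f' (s - 1)`. As `g` misses `f' (s + 1)`, `g * y` hits it.
        · have ha : X.Adj (f' s) (f' (s - 1)) := (hf'.adj_of_eq (by ring)).symm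
          have hb : X.Adj (f' s) (f' (s + 1)) := hf'.adj_of_eq (by ring)
          obtain ⟨d, h1, h2, h⟩ := hc.exists_neighbors_of_two ha hb (hf'.ne_of_eq (by ring))
          have gs := hg s (by omega) (by omega)
          have gs1 := hg (s - 1) (by omega) (by omega)
          have hk : X.Adj (f₁ s) (f₁ (s + 1)) := hf₁.adj_of_eq (by ring)
          have e1 := aut_adj g hk
          have e2 := aut_adj g (aut_adj y hk)
          rw [hy s (by omega) (by omega)] at e2
          rw [gs, h] at e1 e2
          have n1 : g (f₁ (s + 1)) ≠ f' (s - 1) := by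
            rw [← gs1]
            exact aut_ne (hf₁.ne_of_eq (by ring)).symm
          have n2 : g (y (f₁ (s + 1))) ≠ f' (s - 1) := by
            rw [← gs1, ← hy (s - 1) (by omega) (by omega)]
            exact aut_ne (aut_ne (hf₁.ne_of_eq (by ring)).symm)
          have n3 : g (y (f₁ (s + 1))) ≠ g (f₁ (s + 1)) := aut_ne hne
          rw [aut_mul_apply]
          grind
    obtain ⟨z, hz⟩ := lem f₂ g hf₂ hg
    obtain ⟨z', hz'⟩ := lem f₃ g' hf₃ hg'
    refine ⟨z' * z⁻¹, fun i h0 h1 => ?_⟩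
    push_cast at h1
    rw [aut_mul_apply, ← hz i h0 h1, aut_inv_apply_self, hz' i h0 h1]
  -- hence it fixes the whole line
  have fwd : ∀ f : ℤ → V, IsLine X f → ∀ y : X ≃g X, FixSeg f 0 s y →
      ∀ n : ℕ, FixSeg f 0 (s + n) y := by
    intro f hf y hy n
    induction n with
    | zero => simpa using hy
    | succ n ih =>
      push_cast
      rw [← add_assoc]
      refine ih.succ ?_
      have := key _ (hf.shift n) y (fun k h1 h2 => ih _ (by omega) (by omega))
      rwa [show ((s : ℤ) + 1 + n) = s + n + 1 by ring] at this
  have all : ∀ f : ℤ → V, IsLine X f → ∀ y : X ≃g X, FixSeg f 0 s y → ∀ i, y (f i) = f i := by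
    intro f hf y hy i
    rcases le_or_gt 0 i with h | h
    · exact fwd f hf y hy i.toNat i h (by omega)
    · have := fwd _ (hf.reverse s) y (fun k h1 h2 => hy _ (by omega) (by omega)) (-i).toNat
        (s - i) (by omega) (by omega)
      simpa using this
  -- The vertices lying on some line that `x` fixes pointwise; this set is closed under adjacency.
  let R : V → Prop := fun w => ∃ f, IsLine X f ∧ (∀ i, x (f i) = f i) ∧ f 0 = w
  have hR : ∀ u w, X.Adj u w → R u → R w := by
    rintro u w huw ⟨f, hf, hfx, rfl⟩
    by_cases h : w = f (-1)
    · exact ⟨_, hf.shift (-1), fun i => hfx _, by simpa using h.symm⟩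
    · obtain ⟨f', hf', h1, h2⟩ := hc.exists_line_modify hf 0 huw (by simpa using h)
      -- The bent line keeps the old `s`-arc ending at index 0, which already forces `x` to fix all
      -- of it.
      have h3 : ∀ i, x (f' i) = f' i := by
        intro i
        have := all _ (hf'.shift (-s)) x (fun k hk1 hk2 => by
          have := hfx (k + -s)
          rwa [← h1 _ (by omega)] at this) (i + s)
        simpa using this
      refine ⟨_, hf'.shift 1, fun i => h3 _, by simpa using h2⟩
  have hR0 : R (f 0) := ⟨f, hf, all f hf x hx, rfl⟩
  have hRall : ∀ w, R w := by
    intro w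
    obtain ⟨p⟩ := hconn.preconnected (f 0) w
    clear hx hcon
    generalize f 0 = u at hR0 p
    induction p with
    | nil => exact hR0
    | cons h p ih => exact ih (hR _ _ h hR0)
  ext w
  obtain ⟨f, -, h, rfl⟩ := hRall w
  exact h 0

/-- In a finite connected cubic graph that is `2`-arc-transitive there is `s ≥ 2` for which the
automorphism group is transitive on `s`-arcs with trivial stabilizers. -/
theorem IsCubic.exists_lineTrans_rigid [Finite V] (hc : IsCubic X) (hconn : X.Connected)
    (h2 : LineTrans X 2) : ∃ s : ℕ, 2 ≤ s ∧ LineTrans X s ∧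
      ∀ f, IsLine X f → ∀ x : X ≃g X, FixSeg f 0 s x → x = 1 := by
  by_contra hcon
  push Not at hcon
  have hall : ∀ s : ℕ, LineTrans X (s + 2) := by
    intro s
    induction s with
    | zero => exact h2
    | succ s ih =>
      obtain ⟨f, hf, x, hx, hx1⟩ := hcon (s + 2) (by omega) ih
      exact hc.lineTrans_succ hconn (by omega) ih hf hx hx1
  obtain ⟨v⟩ := hconn.nonempty
  obtain ⟨a, b, c, hab, -, -, hn⟩ := hc.exists_neighbors v
  obtain ⟨f, hf, -⟩ := hc.exists_line ((hn a).2 (by simp)).symm ((hn b).2 (by simp)) hab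
  have : Finite (X ≃g X) := Finite.of_injective _ RelIso.toEquiv_injective
  -- With transitivity for every `s`, these stabilizers in a finite group would shrink strictly
  -- forever.
  let S : ℕ → Set (X ≃g X) := fun n => {g | FixSeg f 0 (n + 2) g}
  have hlt : ∀ n, (S (n + 1)).ncard < (S n).ncard := by
    intro n
    apply Set.ncard_lt_ncard _ (Set.toFinite _)
    have hle : S (n + 1) ≤ S n := fun g (hg : FixSeg f 0 _ g) =>
      hg.mono le_rfl (by push_cast; omega)
    refine lt_of_le_of_ne hle (fun he => ?_)
    obtain ⟨w, hw, hw1, hw2⟩ := hc.exists_ne_ne (f (n + 2 - 1)) (f (n + 2 + 1)) (f (n + 2))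
    obtain ⟨f', hf', h1, h2⟩ := hc.exists_line_modify hf (n + 2) hw hw1
    -- Transitivity on `(n + 3)`-arcs: `g` fixes the first `n + 3` vertices and moves the next.
    obtain ⟨g, hg⟩ := hall (n + 1) f f' hf hf'
    have hgS : g ∈ S n := fun k hk1 hk2 => by
      rw [hg k hk1 (by push_cast; omega), h1 k hk2]
    rw [← he] at hgS
    have e1 := hgS (n + 2 + 1) (by omega) (by push_cast; omega)
    rw [hg (n + 2 + 1) (by omega) (by push_cast; omega), h2] at e1
    exact hw2 e1
  have hbound : ∀ n, (S n).ncard + n ≤ (S 0).ncard := by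
    intro n
    induction n with
    | zero => simp
    | succ n ih => have := hlt n; omega
  have := hbound ((S 0).ncard + 1)
  omega

end Cubic

/-! ### Tutte-style analysis of arc stabilizers along a line -/

section Shunt

variable {V : Type*} {X : SimpleGraph V}

/-- A line `v` with nontrivial automorphisms `x i` fixing `v i, …, v (i + s - 1)`, when only the
identity fixes `s + 1` consecutive vertices of the line. -/
structure ShuntSystem (X : SimpleGraph V) (s : ℤ) (v : ℤ → V) (x : ℤ → X ≃g X) : Prop where
  line : IsLine X v
  rigid : ∀ (i : ℤ) (g : X ≃g X), FixSeg v i (i + s) g → g = 1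
  fix : ∀ i, FixSeg v i (i + s - 1) (x i)
  ne_one : ∀ i, x i ≠ 1
  -- The trace left by the shunt: the `x i` will be conjugates of one element by its powers.
  comm_shift : ∀ i j k, Commute (x i) (x j) → Commute (x (i + k)) (x (j + k))

namespace ShuntSystem

variable {s : ℤ} {v : ℤ → V} {x : ℤ → X ≃g X}

theorem moves_right (S : ShuntSystem X s v x) (i : ℤ) : x i (v (i + s)) ≠ v (i + s) := fun h =>
  S.ne_one i (S.rigid i _ fun k h1 h2 => by
    rcases h2.lt_or_eq with h2 | rfl
    · exact S.fix i k h1 (by omega)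
    · exact h)

theorem moves_left (S : ShuntSystem X s v x) (i : ℤ) : x i (v (i - 1)) ≠ v (i - 1) := fun h =>
  S.ne_one i (S.rigid (i - 1) _ fun k h1 h2 => by
    rcases h1.lt_or_eq with h1 | rfl
    · exact S.fix i k (by omega) (by omega)
    · exact h)

theorem rigid' (S : ShuntSystem X s v x) {i j : ℤ} {g : X ≃g X} (h : FixSeg v i j g)
    (hij : i + s ≤ j) : g = 1 := S.rigid i g (h.mono le_rfl hij)

/-- Multiplying by the right `x t` extends the fixed segment by one vertex. -/
theorem peel (S : ShuntSystem X s v x) (hc : IsCubic X) {i j t : ℤ} {g : X ≃g X}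
    (hij : i < j) (ht : t = j + 1 - s) (hti : t ≤ i) (h : FixSeg v i j g)
    (hm : g (v (j + 1)) ≠ v (j + 1)) : FixSeg v i (j + 1) (x t * g) := by
  subst ht
  have hx : FixSeg v i j (x (j + 1 - s)) := (S.fix _).mono hti (by omega)
  refine (hx.mul h).succ (hc.mul_fix_of_moves (h j hij.le le_rfl) (hx j hij.le le_rfl)
    (S.line.adj_of_eq (i := j - 1) (by ring)).symm (S.line.adj j) (h _ (by omega) (by omega))
    (hx _ (by omega) (by omega)) hm ?_)
  have := S.moves_right (j + 1 - s)
  rwa [sub_add_cancel] at this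

/-- At `v (i + s - 1)` only two neighbours are available for `v (i + s)`, so a second application of
`x i` returns it, and rigidity applies. -/
theorem mul_self (S : ShuntSystem X s v x) (hc : IsCubic X) (hs : 2 ≤ s) (i : ℤ) :
    x i * x i = 1 := by
  have h := S.moves_right i
  rw [show i + s = i + s - 1 + 1 by ring] at h
  have := S.peel hc (t := i) (by omega) (by ring) le_rfl (S.fix i) h
  exact S.rigid' this (by omega)

theorem inv_eq (S : ShuntSystem X s v x) (hc : IsCubic X) (hs : 2 ≤ s) (i : ℤ) :
    (x i)⁻¹ = x i := inv_eq_of_mul_eq_one_left (S.mul_self hc hs i)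

/-- The pointwise stabilizer of a segment is generated by the `x t` it contains. -/
theorem mem_closure (S : ShuntSystem X s v x) (hc : IsCubic X) (n : ℕ) :
    ∀ (i j : ℤ) (g : X ≃g X), i + s ≤ j + n → i < j → FixSeg v i j g →
      g ∈ Subgroup.closure {y | ∃ t, j - s < t ∧ t ≤ i ∧ x t = y} := by
  induction n with
  | zero =>
    intro i j g hn hij h
    rw [S.rigid' h (by simpa using hn)]
    exact one_mem _
  | succ n ih =>
    intro i j g hn hij h
    by_cases hle : i + s ≤ j
    · rw [S.rigid' h hle]
      exact one_mem _
    have hmono : Subgroup.closure {y | ∃ t, j + 1 - s < t ∧ t ≤ i ∧ x t = y} ≤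
        Subgroup.closure {y | ∃ t, j - s < t ∧ t ≤ i ∧ x t = y} :=
      Subgroup.closure_mono fun y ⟨t, h1, h2, h3⟩ => ⟨t, by omega, h2, h3⟩
    push_cast at hn
    by_cases hm : g (v (j + 1)) = v (j + 1)
    · exact hmono (ih i (j + 1) g (by omega) (by omega) (h.succ hm))
    -- `x (j + 1 - s)` is the generator whose fixed segment ends exactly at `v j`.
    · have h1 := S.peel hc hij rfl (by omega) h hm
      have h2 := hmono (ih i (j + 1) _ (by omega) (by omega) h1)
      have h3 : x (j + 1 - s) ∈ Subgroup.closure {y | ∃ t, j - s < t ∧ t ≤ i ∧ x t = y} :=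
        Subgroup.subset_closure ⟨_, by omega, by omega, rfl⟩
      exact (Subgroup.mul_mem_cancel_left _ h3).1 h2

theorem mem_closure' (S : ShuntSystem X s v x) (hc : IsCubic X) {i j : ℤ}
    {g : X ≃g X} (hij : i < j) (h : FixSeg v i j g) :
    g ∈ Subgroup.closure {y | ∃ t, j - s < t ∧ t ≤ i ∧ x t = y} :=
  S.mem_closure hc (i + s - j).toNat i j g (by omega) hij h

/-- An element commuting with all `x t` of a segment commutes with its pointwise stabilizer. -/
theorem commute_of_fixSeg (S : ShuntSystem X s v x) (hc : IsCubic X) {i j : ℤ}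
    {g y : X ≃g X} (hij : i < j) (h : FixSeg v i j g)
    (hy : ∀ t, j - s < t → t ≤ i → Commute (x t) y) : Commute g y := by
  have h1 := S.mem_closure' hc hij h
  have h2 : Subgroup.closure {y | ∃ t, j - s < t ∧ t ≤ i ∧ x t = y} ≤
      Subgroup.centralizer {y} := by
    rw [Subgroup.closure_le]
    rintro _ ⟨t, ht1, ht2, rfl⟩
    exact Subgroup.mem_centralizer_singleton_iff.2 (hy t ht1 ht2).eq
  exact Subgroup.mem_centralizer_singleton_iff.1 (h2 h1)

theorem commute_iff (S : ShuntSystem X s v x) {i j k l : ℤ} (h : j - i = l - k) :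
    Commute (x i) (x j) ↔ Commute (x k) (x l) := by
  constructor <;> intro h'
  · have := S.comm_shift i j (k - i) h'
    rwa [show i + (k - i) = k by ring, show j + (k - i) = l by omega] at this
  · have := S.comm_shift k l (i - k) h'
    rwa [show k + (i - k) = i by ring, show l + (i - k) = j by omega] at this

/-- The offset `s - 1 + l` makes `x (l - i)` fix the reversed segment starting at `i`. This
exchanges `x 0` and `x l`, so that bounds on one end of a commutator's fixed segment carry over to
the other. -/
theorem reverse (S : ShuntSystem X s v x) (l : ℤ) :
    ShuntSystem X s (fun j => v (s - 1 + l - j)) (fun i => x (l - i)) where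
  line := S.line.reverse _
  rigid i g h := S.rigid (l - 1 - i) g fun k h1 h2 => by
    have := h (s - 1 + l - k) (by omega) (by omega)
    simpa using this
  fix i k h1 h2 := S.fix (l - i) _ (by omega) (by omega)
  ne_one i := S.ne_one _
  comm_shift i j k h := (S.commute_iff (by ring)).1 h

/-- The commutator `[x 0, x j]` fixes a longer segment than the obvious one. -/
theorem commutator_fix (S : ShuntSystem X s v x) (hc : IsCubic X) {j : ℤ} (h1 : 1 ≤ j)
    (h2 : j ≤ s - 2) : FixSeg v (j - 1) s (x 0 * x j * x 0 * x j) ∧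
      FixSeg v (j - 1) s (x j * x 0 * x j * x 0) := by
  -- `x 0` fixes every neighbour of `v j`, and `x j` every neighbour of `v (s - 1)`
  have a0 : ∀ k, 0 ≤ k → k ≤ s - 1 → x 0 (v k) = v k := fun k h h' => S.fix 0 k h (by omega)
  have aj : ∀ k, j ≤ k → k ≤ j + s - 1 → x j (v k) = v k := fun k h h' => S.fix j k h (by omega)
  have n0 : ∀ c, X.Adj (v j) c → x 0 c = c := fun c hcj =>
    hc.fix_of_fix_two (a0 j (by omega) (by omega))
      (S.line.adj_of_eq (i := j - 1) (by ring)).symm (S.line.adj j)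
      (S.line.ne_of_eq (by ring)) (a0 _ (by omega) (by omega)) (a0 _ (by omega) (by omega)) hcj
  have nj : ∀ c, X.Adj (v (s - 1)) c → x j c = c := fun c hcj =>
    hc.fix_of_fix_two (aj (s - 1) (by omega) (by omega))
      (S.line.adj_of_eq (i := s - 1 - 1) (by ring)).symm
      (S.line.adj_of_eq (j := s) (by ring)) (S.line.ne_of_eq (by ring))
      (aj _ (by omega) (by omega)) (aj _ (by omega) (by omega)) hcj
  have b1 : X.Adj (v j) (v (j - 1)) := (S.line.adj_of_eq (by ring)).symm
  have b2 : X.Adj (v (s - 1)) (v s) := S.line.adj_of_eq (by ring)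
  have c1 : ∀ y, X.Adj (v j) y → X.Adj (v j) (x j y) := fun y hy => by
    have := aut_adj (x j) hy
    rwa [aj j le_rfl (by omega)] at this
  have c2 : ∀ y, X.Adj (v (s - 1)) y → X.Adj (v (s - 1)) (x 0 y) := fun y hy => by
    have := aut_adj (x 0) hy
    rwa [a0 (s - 1) (by omega) (by omega)] at this
  have hsq0 := S.mul_self hc (by omega) 0
  have hsqj := S.mul_self hc (by omega) j
  have s0 : ∀ y, x 0 (x 0 y) = y := fun y => by rw [← aut_mul_apply, hsq0]; rfl
  have sj : ∀ y, x j (x j y) = y := fun y => by rw [← aut_mul_apply, hsqj]; rfl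
  constructor
  · intro k hk1 hk2
    simp only [aut_mul_apply]
    rcases hk1.lt_or_eq with hk1 | rfl
    · rcases hk2.lt_or_eq with hk2 | rfl
      · rw [aj k (by omega) (by omega), a0 k (by omega) (by omega), aj k (by omega) (by omega),
          a0 k (by omega) (by omega)]
      · rw [nj _ b2, nj _ (c2 _ b2), s0]
    · rw [n0 _ (c1 _ b1), sj, n0 _ b1]
  · intro k hk1 hk2
    simp only [aut_mul_apply]
    rcases hk1.lt_or_eq with hk1 | rfl
    · rcases hk2.lt_or_eq with hk2 | rfl
      · rw [a0 k (by omega) (by omega), aj k (by omega) (by omega), a0 k (by omega) (by omega),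
          aj k (by omega) (by omega)]
      · rw [nj _ (c2 _ b2), s0, nj _ b2]
    · rw [n0 _ b1, n0 _ (c1 _ b1), sj]

/-- The commutator of the first non-commuting pair fixes one more vertex, as long as there is
room. -/
theorem commutator_fix_succ (S : ShuntSystem X s v x) (hc : IsCubic X) {l α : ℤ}
    (hcomm : ∀ i j, |i - j| < l → Commute (x i) (x j)) (hn : ¬ Commute (x 0) (x l))
    (h1 : 1 ≤ α) (h2 : α < l) (h3 : l + α ≤ s - 2)
    (hfix : FixSeg v (l - 1) (s + α - 1) (x 0 * x l * x 0 * x l)) :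
    FixSeg v (l - 1) (s + α) (x 0 * x l * x 0 * x l) := by
  have hs : 2 ≤ s := by omega
  have hsq := S.mul_self hc hs
  have hfix' := hfix.succ
  rw [sub_add_cancel] at hfix'
  refine hfix' ?_
  by_contra hm
  have hpeel := S.peel hc (t := α) (by omega) (by ring) (by omega) hfix
    (by rwa [sub_add_cancel])
  rw [sub_add_cancel] at hpeel
  -- The product is generated by the `x t` with `α < t < l`, all at distance less than `l` from `l +
  -- α`.
  have hca : Commute (x α * (x 0 * x l * x 0 * x l)) (x (l + α)) :=
    S.commute_of_fixSeg hc (by omega) hpeel fun t ht1 ht2 =>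
      hcomm _ _ (abs_lt.2 ⟨by omega, by omega⟩)
  -- This commutator is generated by the `x t` with `0 < t < l + α`, all at distance less than `l`
  -- from `l`.
  have hd : Commute (x 0 * x (l + α) * x 0 * x (l + α)) (x l) :=
    S.commute_of_fixSeg hc (by omega) (S.commutator_fix hc (j := l + α) (by omega) h3).1
      fun t ht1 ht2 => hcomm _ _ (abs_lt.2 ⟨by omega, by omega⟩)
  have hlj : Commute (x l) (x (l + α)) := hcomm _ _ (abs_lt.2 ⟨by omega, by omega⟩)
  have hcc : Commute (x 0 * x l * x 0 * x l) (x (l + α)) := by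
    -- conjugation by `x (l + α)` fixes `x l` and takes `x 0` to `x 0` times something
    -- commuting with `x l`
    have i0 := S.inv_eq hc hs 0
    have ij := S.inv_eq hc hs (l + α)
    have il := S.inv_eq hc hs l
    have q0 := hsq 0
    have qj := hsq (l + α)
    generalize x 0 = a at *
    generalize x (l + α) = b at *
    generalize x l = e at *
    have e1 : b * a * b * e * (b * a * b) = a * e * a := by
      have hd' := hd.eq
      calc b * a * b * e * (b * a * b)
          = a * (a * b * a * b * e) * (b * a * b) := by
            rw [show a * (a * b * a * b * e) = (a * a) * (b * a * b * e) by group, q0]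
            group
        _ = a * e * a * b * a * (b * b) * a * b := by rw [hd']; group
        _ = a * e * a * b * (a * a) * b := by rw [qj]; group
        _ = a * e * a * (b * b) := by rw [q0]; group
        _ = a * e * a := by rw [qj]; group
    have e2 : b * e * b = e := by rw [← hlj.eq, mul_assoc, qj, mul_one]
    have e3 : b * (a * e * a * e) * b = a * e * a * e := by
      calc b * (a * e * a * e) * b
          = b * a * (b * b) * e * (b * b) * a * (b * b) * e * b := by rw [qj]; group
        _ = b * a * b * (b * e * b) * (b * a * b) * (b * e * b) := by group
        _ = b * a * b * e * (b * a * b) * e := by rw [e2]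
        _ = a * e * a * e := by rw [e1]
    calc a * e * a * e * b = (b * b) * (a * e * a * e) * b := by rw [qj, one_mul]
      _ = b * (b * (a * e * a * e) * b) := by group
      _ = b * (a * e * a * e) := by rw [e3]
  -- Cancelling the commutator leaves a commuting pair at distance `l`, which is excluded.
  have hfin : Commute (x α) (x (l + α)) := by
    have := hca.mul_left hcc.inv_left
    rwa [mul_inv_cancel_right] at this
  exact hn ((S.commute_iff (by ring)).1 hfin)

/-- `commutator_fix` reaches `v s`; then `commutator_fix_succ` with `α = 1, 2, …` adds one vertex at
a time. If `α` reaches `l` first, the segment already has `s + 1` vertices and the commutator is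
trivial. -/
theorem commutator_fix_long (S : ShuntSystem X s v x) (hc : IsCubic X) {l : ℤ}
    (hcomm : ∀ i j, |i - j| < l → Commute (x i) (x j)) (hn : ¬ Commute (x 0) (x l))
    (h1 : 1 ≤ l) (h2 : l ≤ s - 2) :
    FixSeg v (l - 1) (2 * s - 2 - l) (x 0 * x l * x 0 * x l) := by
  have key : ∀ n : ℕ, l + n ≤ s - 2 → FixSeg v (l - 1) (s + n) (x 0 * x l * x 0 * x l) := by
    intro n
    induction n with
    | zero =>
      intro _
      simpa using (S.commutator_fix hc h1 h2).1
    | succ n ih =>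
      intro hle
      push_cast at hle
      have hf := ih (by omega)
      rcases lt_or_ge ((n : ℤ) + 1) l with hlt | hge
      · refine S.commutator_fix_succ hc hcomm hn (by omega) (by push_cast; omega)
          (by push_cast; omega) ?_
        refine hf.mono le_rfl ?_
        push_cast
        omega
      · rw [S.rigid' hf (by omega)]
        exact fun k _ _ => rfl
  exact (key (s - 2 - l).toNat (by omega)).mono le_rfl (by omega)

/-- The generators in the middle of the vertex stabilizers cannot be central. -/
theorem exists_not_commute (S : ShuntSystem X s v x) (hc : IsCubic X) (hconn : X.Connected)
    {i : ℤ} (h1 : 1 ≤ i) (h2 : i ≤ s - 1) :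
    ∃ t, 0 ≤ t ∧ t ≤ s ∧ ¬ Commute (x t) (x i) := by
  by_contra hcon
  push Not at hcon
  apply S.ne_one i
  let B : Subgroup (X ≃g X) := Subgroup.centralizer {x i}
  have hB : ∀ t, 0 ≤ t → t ≤ s → x t ∈ B := fun t h h' =>
    Subgroup.mem_centralizer_singleton_iff.2 (hcon t h h').eq
  -- The fixed vertices of `x i` form a `B`-invariant set containing `v (s - 1)` and `v s`, as `1 ≤
  -- i ≤ s - 1`; it remains to reach every vertex from these two by `B`.
  have hBfix : ∀ b ∈ B, ∀ u, x i u = u → x i (b u) = b u := by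
    intro b hb u hu
    have := Subgroup.mem_centralizer_singleton_iff.1 hb
    rw [← aut_mul_apply, ← this, aut_mul_apply, hu]
  -- `B` is transitive on the neighbours of two consecutive vertices
  have nb : ∀ j, (j = s - 1 ∨ j = s) → ∀ w, X.Adj (v j) w →
      ∃ b ∈ B, (w = b (v (j - 1)) ∨ w = b (v (j + 1))) := by
    intro j hj w hw
    have ha : X.Adj (v j) (v (j - 1)) := (S.line.adj_of_eq (by ring)).symm
    have hb : X.Adj (v j) (v (j + 1)) := S.line.adj j
    obtain ⟨d, d1, d2, hd⟩ := hc.exists_neighbors_of_two ha hb (S.line.ne_of_eq (by ring))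
    rcases (hd w).1 hw with rfl | rfl | rfl
    · exact ⟨1, one_mem _, Or.inl rfl⟩
    · exact ⟨1, one_mem _, Or.inr rfl⟩
    -- `x (j - s + 1)` fixes a segment ending at `v j` and moves `v (j + 1)`, so it swaps `v (j +
    -- 1)` with the third neighbour.
    · have hx : FixSeg v (j - 1) j (x (j - s + 1)) := (S.fix _).mono (by omega) (by omega)
      refine ⟨x (j - s + 1), hB _ (by omega) (by omega), Or.inr ?_⟩
      have h3 := aut_adj (x (j - s + 1)) hb
      rw [hx j (by omega) le_rfl, hd] at h3
      rcases h3 with h3 | h3 | h3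
      · exact absurd ((x (j - s + 1)).injective (h3.trans (hx _ le_rfl (by omega)).symm))
          (S.line.ne_of_eq (by ring)).symm
      · have := S.moves_right (j - s + 1)
        rw [show j - s + 1 + s = j + 1 by ring] at this
        exact absurd h3 this
      · exact h3.symm
  -- some element of `B` takes `v (j + 1)` to `v (j - 1)`
  have flip : ∀ j, (j = s - 1 ∨ j = s) → ∃ b ∈ B, b (v (j - 1)) = v (j + 1) ∧ b (v j) = v j := by
    intro j hj
    have ha : X.Adj (v j) (v (j - 1)) := (S.line.adj_of_eq (by ring)).symm
    have hb : X.Adj (v j) (v (j + 1)) := S.line.adj j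
    obtain ⟨d, d1, d2, hd⟩ := hc.exists_neighbors_of_two ha hb (S.line.ne_of_eq (by ring))
    have hx : FixSeg v (j - 1) j (x (j - s + 1)) := (S.fix _).mono (by omega) (by omega)
    have hy : FixSeg v j (j + 1) (x j) := (S.fix _).mono (by omega) (by omega)
    -- Through the third neighbour `d`: `x j` takes `v (j - 1)` to `d`, and `x (j - s + 1)` takes `v
    -- (j + 1)` to `d`.
    refine ⟨(x (j - s + 1))⁻¹ * x j, mul_mem (inv_mem (hB _ (by omega) (by omega)))
      (hB _ (by omega) (by omega)), ?_, ?_⟩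
    · have h3 := aut_adj (x (j - s + 1)) hb
      rw [hx j (by omega) le_rfl, hd] at h3
      have h4 := aut_adj (x j) ha
      rw [hy j le_rfl (by omega), hd] at h4
      have e3 : x (j - s + 1) (v (j + 1)) = d := by
        rcases h3 with h3 | h3 | h3
        · exact absurd ((x (j - s + 1)).injective (h3.trans (hx _ le_rfl (by omega)).symm))
            (S.line.ne_of_eq (by ring)).symm
        · have := S.moves_right (j - s + 1)
          rw [show j - s + 1 + s = j + 1 by ring] at this
          exact absurd h3 this
        · exact h3
      have e4 : x j (v (j - 1)) = d := by
        rcases h4 with h4 | h4 | h4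
        · exact absurd h4 (S.moves_left j)
        · exact absurd ((x j).injective (h4.trans (hy _ (by omega) le_rfl).symm))
            (S.line.ne_of_eq (by ring))
        · exact h4
      rw [aut_mul_apply, e4, ← e3, aut_inv_apply_self]
    · rw [aut_mul_apply, hy j le_rfl (by omega), aut_inv_fix (hx j (by omega) le_rfl)]
  let R : V → Prop := fun u => ∃ b ∈ B, b (v (s - 1)) = u ∨ b (v s) = u
  obtain ⟨b₁, hb₁, e₁, e₁'⟩ := flip (s - 1) (Or.inl rfl)
  obtain ⟨b₂, hb₂, e₂, e₂'⟩ := flip s (Or.inr rfl)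
  rw [sub_add_cancel] at e₁
  have hstep : ∀ u w, X.Adj u w → R u → R w := by
    rintro u w huw ⟨b, hb, rfl | rfl⟩
    · have h3 := aut_adj b⁻¹ huw
      rw [aut_inv_apply_self] at h3
      obtain ⟨b', hb', h4⟩ := nb (s - 1) (Or.inl rfl) _ h3
      rw [sub_add_cancel] at h4
      rcases h4 with h4 | h4
      · refine ⟨b * b' * b₁⁻¹, mul_mem (mul_mem hb hb') (inv_mem hb₁), Or.inr ?_⟩
        rw [aut_mul_apply, ← e₁, aut_inv_apply_self, aut_mul_apply, ← h4, aut_apply_inv_self]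
      · refine ⟨b * b', mul_mem hb hb', Or.inr ?_⟩
        rw [aut_mul_apply, ← h4, aut_apply_inv_self]
    · have h3 := aut_adj b⁻¹ huw
      rw [aut_inv_apply_self] at h3
      obtain ⟨b', hb', h4⟩ := nb s (Or.inr rfl) _ h3
      rcases h4 with h4 | h4
      · refine ⟨b * b', mul_mem hb hb', Or.inl ?_⟩
        rw [aut_mul_apply, ← h4, aut_apply_inv_self]
      · refine ⟨b * b' * b₂, mul_mem (mul_mem hb hb') hb₂, Or.inl ?_⟩
        rw [aut_mul_apply, e₂, aut_mul_apply, ← h4, aut_apply_inv_self]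
  have hR : ∀ u, R u := by
    intro u
    obtain ⟨p⟩ := hconn.preconnected (v s) u
    have h0 : R (v s) := ⟨1, one_mem _, Or.inr rfl⟩
    generalize v s = a at h0 p
    induction p with
    | nil => exact h0
    | cons h p ih => exact ih (hstep _ _ h h0)
  ext u
  obtain ⟨b, hb, h | h⟩ := hR u
  · rw [← h]
    exact hBfix b hb _ (S.fix i _ h2 (by omega))
  · rw [← h]
    exact hBfix b hb _ (S.fix i _ (by omega) (by omega))

/-- If the generators are odd for some sign character `σ`, then the segments are short, and no
odd involution flips the two ends of an edge of the line pointwise fixed by it. -/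
theorem false_of_odd (S : ShuntSystem X s v x) (hc : IsCubic X) (hconn : X.Connected)
    (hs : 3 ≤ s) (σ : (X ≃g X) →* ℤˣ) {p : X ≃g X} (hp : p * p = 1) (hpσ : σ p = -1)
    (hσ : ∀ i j, σ (x i) = σ (x j)) (hfix : FixSeg v (s - 2) (s - 1) p)
    (hl : p (v (s - 3)) ≠ v (s - 3)) (hr : p (v s) ≠ v s) : False := by
  have hs2 : 2 ≤ s := by omega
  have hsq := S.mul_self hc hs2
  -- all generators are odd
  have hodd : ∀ i, σ (x i) = -1 := by
    by_contra hcon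
    push Not at hcon
    obtain ⟨i, hi⟩ := hcon
    have hi1 : ∀ j, σ (x j) = 1 := fun j =>
      (hσ j i).trans ((Int.units_eq_one_or _).resolve_right hi)
    -- Otherwise everything fixing `v (s - 2)` and `v (s - 1)`, including `p`, would be even.
    have hle : Subgroup.closure {y | ∃ t, s - 1 - s < t ∧ t ≤ s - 2 ∧ x t = y} ≤ σ.ker := by
      rw [Subgroup.closure_le]
      rintro _ ⟨t, -, -, rfl⟩
      exact hi1 t
    have hp1 : σ p = 1 := hle (S.mem_closure' hc (by omega) hfix)
    rw [hpσ] at hp1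
    exact absurd hp1 (by decide)
  -- `p` is a product of `x (s - 2)`, an element of a smaller stabilizer, and `x 0`
  have hx0 : FixSeg v (s - 3) (s - 1) (x 0) := (S.fix 0).mono (by omega) (by omega)
  have hx2 : FixSeg v (s - 2) s (x (s - 2)) := (S.fix _).mono (by omega) (by omega)
  have hmr := S.moves_right 0
  rw [zero_add] at hmr
  have hml := S.moves_left (s - 2)
  rw [show s - 2 - 1 = s - 3 by ring] at hml
  have e1 : (p * x 0) (v s) = v s :=
    hc.mul_fix_of_moves (hx0 (s - 1) (by omega) le_rfl) (hfix (s - 1) (by omega) le_rfl)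
      (S.line.adj_of_eq (i := s - 2) (by ring)).symm (S.line.adj_of_eq (by ring))
      (hx0 (s - 2) (by omega) (by omega)) (hfix _ (by omega) (by omega)) hmr hr
  have e2 : (x (s - 2) * p) (v (s - 3)) = v (s - 3) :=
    hc.mul_fix_of_moves (hfix (s - 2) le_rfl (by omega)) (hx2 (s - 2) le_rfl (by omega))
      (S.line.adj_of_eq (i := s - 2) (by ring))
      (S.line.adj_of_eq (i := s - 3) (by ring)).symm (hfix (s - 1) (by omega) le_rfl)
      (hx2 (s - 1) (by omega) (by omega)) hl hml
  obtain ⟨n, hn⟩ : ∃ n, n = x (s - 2) * p * x 0 := ⟨_, rfl⟩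
  have hnfix : FixSeg v (s - 3) s n := by
    intro k h1 h2
    rw [hn]
    rcases h1.lt_or_eq with h1 | rfl
    · rcases h2.lt_or_eq with h2 | rfl
      · rw [aut_mul_apply, aut_mul_apply, hx0 k (by omega) (by omega),
          hfix k (by omega) (by omega), hx2 k (by omega) (by omega)]
      · rw [mul_assoc, aut_mul_apply, e1, hx2 _ (by omega) le_rfl]
    · rw [aut_mul_apply, hx0 _ le_rfl (by omega), e2]
  have hpn : p = x (s - 2) * n * x 0 := by
    rw [hn]
    calc p = 1 * p * 1 := by group
      _ = (x (s - 2) * x (s - 2)) * p * (x 0 * x 0) := by rw [hsq, hsq]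
      _ = _ := by group
  rcases hs.lt_or_eq with hs | rfl
  swap
  -- For `s = 3` the element `n` fixes four consecutive vertices, so `p = x 1 * x 0` would be even.
  · rw [S.rigid' hnfix (by norm_num)] at hpn
    rw [hpn, map_mul, map_mul, hodd, hodd, map_one] at hpσ
    exact absurd hpσ (by decide)
  -- the first non-commuting pair
  have hex : ∃ d : ℕ, ¬ Commute (x 0) (x d) ∧ 2 * (d : ℤ) ≤ s + 1 := by
    -- The middle index is within `(s + 1) / 2` of every `t` in `[0, s]`.
    obtain ⟨t, h1, h2, h3⟩ := S.exists_not_commute hc hconn (i := s / 2) (by omega) (by omega)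
    rcases le_total t (s / 2) with h | h
    · refine ⟨(s / 2 - t).toNat, fun h4 => h3 ((S.commute_iff ?_).1 h4), by omega⟩
      omega
    · refine ⟨(t - s / 2).toNat, fun h4 => h3 ((S.commute_iff ?_).1 h4).symm, by omega⟩
      omega
  classical
  have hexn : ∃ d : ℕ, ¬ Commute (x 0) (x d) := hex.imp fun _ h => h.1
  obtain ⟨l, hl⟩ : ∃ l, l = Nat.find hexn := ⟨_, rfl⟩
  have hnl : ¬ Commute (x 0) (x (l : ℤ)) := hl ▸ Nat.find_spec hexn
  have hl2 : 2 * (l : ℤ) ≤ s + 1 := by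
    obtain ⟨d, h1, h2⟩ := hex
    have : l ≤ d := hl ▸ Nat.find_min' hexn h1
    omega
  have hl1 : 1 ≤ l := by
    rcases Nat.eq_zero_or_pos l with h | h
    · rw [h] at hnl
      exact absurd (Commute.refl _) hnl
    · exact h
  have hcomm : ∀ i j, |i - j| < (l : ℤ) → Commute (x i) (x j) := by
    intro i j hij
    have hlow : ∀ d : ℕ, d < l → Commute (x 0) (x d) := fun d hd => by
      have := Nat.find_min hexn (hl ▸ hd)
      rwa [not_not] at this
    rw [abs_lt] at hij
    rcases le_total i j with h | h
    · exact (S.commute_iff (by omega)).1 (hlow (j - i).toNat (by omega))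
    · exact ((S.commute_iff (by omega)).1 (hlow (i - j).toNat (by omega))).symm
  have hc1 := S.commutator_fix_long hc hcomm hnl (by omega) (by omega)
  have hc2 := (S.reverse l).commutator_fix_long hc (l := l)
    (fun i j h => hcomm _ _ (by rwa [show (l : ℤ) - i - (l - j) = -(i - j) by ring, abs_neg]))
    (by
      simp only [sub_zero, sub_self]
      exact fun h => hnl h.symm) (by omega) (by omega)
  simp only [sub_zero, sub_self] at hc2
  have hc3 : FixSeg v (2 * l - s + 1) s (x 0 * x l * x 0 * x l) := by
    have hinv : x 0 * x l * x 0 * x l = (x l * x 0 * x l * x 0)⁻¹ := by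
      simp only [mul_inv_rev, S.inv_eq hc hs2]
      group
    rw [hinv]
    refine FixSeg.inv fun k h1 h2 => ?_
    have := hc2 (s - 1 + l - k) (by omega) (by omega)
    simpa using this
  have hc4 : FixSeg v (2 * l - s + 1) (2 * s - 2 - l) (x 0 * x l * x 0 * x l) := by
    intro k h1 h2
    rcases le_total k s with h | h
    · exact hc3 k h1 h
    · exact hc1 k (by omega) h2
  have hne : x 0 * x l * x 0 * x l ≠ 1 := by
    intro h
    apply hnl
    have h5 : x 0 * x l * (x 0 * x l) = 1 := by rw [← h]; group
    have h6 := eq_inv_of_mul_eq_one_left h5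
    rwa [mul_inv_rev, S.inv_eq hc hs2, S.inv_eq hc hs2] at h6
  have heven : σ (x 0 * x l * x 0 * x l) = 1 := by
    simp only [map_mul, hodd]
    decide
  -- The commutator fixes `3 * s - 2 - 3 * l` consecutive vertices. With more than `s` it is
  -- trivial; with exactly `s` it is one of the `x t`, which are odd, although a commutator is even.
  have hlow : 2 * s - 1 ≤ 3 * (l : ℤ) := by
    by_contra hcon
    by_cases h : 2 * (l : ℤ) - s + 1 + s ≤ 2 * s - 2 - l
    · exact hne (S.rigid' hc4 h)
    · -- the fixed segment has exactly `s` vertices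
      have hm : (x 0 * x l * x 0 * x l) (v (2 * s - 2 - l + 1)) ≠ v (2 * s - 2 - l + 1) :=
        fun h5 => hne (S.rigid' (hc4.succ h5) (by omega))
      have h6 := S.peel hc (t := 2 * s - 2 - l + 1 - s) (by omega) rfl (by omega) hc4 hm
      have h7 := S.rigid' h6 (by omega)
      have h8 := congrArg σ h7
      rw [map_mul, heven, hodd, map_one] at h8
      exact absurd h8 (by decide)
  -- From `2 * s - 1 ≤ 3 * l`, `2 * l ≤ s + 1` and `s > 3`.
  have hs5 : s = 5 := by omega
  have hl3 : (l : ℤ) = 3 := by omega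
  subst hs5
  rw [hl3] at hcomm hnl
  norm_num at hpn hnfix
  -- here `n` is an involution commuting with both `x 0` and `x 3`
  have k0 : Commute n (x 0) := S.commute_of_fixSeg hc (by norm_num) hnfix fun t h1 h2 =>
    hcomm _ _ (abs_lt.2 ⟨by omega, by omega⟩)
  have k3 : Commute n (x 3) := S.commute_of_fixSeg hc (by norm_num) hnfix fun t h1 h2 =>
    hcomm _ _ (abs_lt.2 ⟨by omega, by omega⟩)
  -- `n` is a product of some of the commuting involutions `x 1` and `x 2`, found by peeling.
  have kn : n * n = 1 := by
    by_cases h6 : n (v (5 + 1)) = v (5 + 1)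
    · have h7 := hnfix.succ h6
      by_cases h8 : n (v (5 + 1 + 1)) = v (5 + 1 + 1)
      · rw [S.rigid' (h7.succ h8) (by norm_num), one_mul]
      · have h9 := S.rigid' (S.peel hc (t := 2) (by norm_num) (by norm_num) (by norm_num) h7 h8)
          (by norm_num)
        rw [eq_inv_of_mul_eq_one_right h9, S.inv_eq hc hs2, hsq]
    · have h7 := S.peel hc (t := 1) (by norm_num) (by norm_num) (by norm_num) hnfix h6
      have k1 : Commute n (x 1) := S.commute_of_fixSeg hc (by norm_num) hnfix
        fun t h1 h2 => hcomm _ _ (abs_lt.2 ⟨by omega, by omega⟩)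
      have h10 : (x 1 * n) * (x 1 * n) = 1 := by
        by_cases h8 : (x 1 * n) (v (5 + 1 + 1)) = v (5 + 1 + 1)
        · rw [S.rigid' (h7.succ h8) (by norm_num), one_mul]
        · have h9 := S.rigid' (S.peel hc (t := 2) (by norm_num) (by norm_num) (by norm_num) h7
            h8) (by norm_num)
          rw [eq_inv_of_mul_eq_one_right h9, S.inv_eq hc hs2, hsq]
      calc n * n = (x 1 * x 1) * n * n := by rw [hsq, one_mul]
        _ = x 1 * (x 1 * n) * n := by group
        _ = x 1 * (n * x 1) * n := by rw [k1.eq]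
        _ = (x 1 * n) * (x 1 * n) := by group
        _ = 1 := h10
  apply hnl
  -- As `n` is central for `x 0` and `x 3` and squares to 1, it drops out of `p * p = 1`.
  have h11 : (x 3 * x 0) * (x 3 * x 0) = 1 := by
    calc (x 3 * x 0) * (x 3 * x 0) = (x 3 * x 0) * (n * n) * (x 3 * x 0) := by
          rw [kn, mul_one]
      _ = x 3 * (n * x 0) * (n * x 3) * x 0 := by rw [k0.eq, k3.eq, mul_assoc, mul_assoc,
            mul_assoc, mul_assoc, mul_assoc, mul_assoc, ← mul_assoc n (x 3), k3.eq, mul_assoc]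
      _ = (x 3 * n * x 0) * (x 3 * n * x 0) := by rw [k3.eq]; group
      _ = 1 := by rw [← hpn, hp]
  have h12 := eq_inv_of_mul_eq_one_left h11
  rw [mul_inv_rev, S.inv_eq hc hs2, S.inv_eq hc hs2] at h12
  exact h12.symm

end ShuntSystem

end Shunt

/-! ### Flips in 2-regular groups, and why odd flips force the full automorphism group -/

section TwoRegular

variable {V : Type*} {X : SimpleGraph V}

/-- `2`-regularity, spelled out for triples of vertices. -/
structure IsTwoRegular (X : SimpleGraph V) (G : Subgroup (X ≃g X)) : Prop where
  trans : ∀ {u v w u' v' w' : V}, X.Adj u v → X.Adj v w → u ≠ w → X.Adj u' v' → X.Adj v' w' →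
    u' ≠ w' → ∃ g ∈ G, g u = u' ∧ g v = v' ∧ g w = w'
  trivial : ∀ {u v w : V}, X.Adj u v → X.Adj v w → u ≠ w → ∀ {g : X ≃g X}, g ∈ G → g u = u →
    g v = v → g w = w → g = 1

theorem isSArc_two {u v w : V} (h : X.Adj u v) (h' : X.Adj v w) (hne : u ≠ w) :
    IsSArc X 2 ![u, v, w] := by
  constructor
  · intro i j hij
    fin_cases i <;> fin_cases j <;> simp_all
  · intro i j hij
    fin_cases i <;> fin_cases j <;> simp_all

theorem IsSRegular.isTwoRegular {G : Subgroup (X ≃g X)} (hG : IsSRegular X 2 G) :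
    IsTwoRegular X G where
  trans h1 h2 h3 h1' h2' h3' := by
    obtain ⟨g, hg, h⟩ := hG.transitive _ _ (isSArc_two h1 h2 h3) (isSArc_two h1' h2' h3')
    exact ⟨g, hg, h 0, h 1, h 2⟩
  trivial h1 h2 h3 g hg e1 e2 e3 := by
    refine hG.stabilizer_trivial _ (isSArc_two h1 h2 h3) g hg fun i => ?_
    fin_cases i
    · exact e1
    · exact e2
    · exact e3

namespace IsTwoRegular

variable {G : Subgroup (X ≃g X)}

theorem arc_trans (hG : IsTwoRegular X G) (hc : IsCubic X) {u v u' v' : V} (h : X.Adj u v)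
    (h' : X.Adj u' v') : ∃ g ∈ G, g u = u' ∧ g v = v' := by
  obtain ⟨w, h1, h2⟩ := hc.exists_ne u v
  obtain ⟨w', h1', h2'⟩ := hc.exists_ne u' v'
  obtain ⟨g, hg, e1, e2, -⟩ := hG.trans h h1 h2.symm h' h1' h2'.symm
  exact ⟨g, hg, e1, e2⟩

/-- 2-arc-transitivity gives an element fixing the arc and exchanging the two other neighbours of
its end; its square fixes a 2-arc. -/
theorem exists_flip (hG : IsTwoRegular X G) (hc : IsCubic X) {u v : V} (h : X.Adj u v) :
    ∃ p ∈ G, p u = u ∧ p v = v ∧ p ≠ 1 ∧ p * p = 1 := by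
  obtain ⟨a, b, h1, h2, h3, hn⟩ := hc.exists_neighbors_of_adj h.symm
  have ha : X.Adj v a := (hn a).2 (by simp)
  have hb : X.Adj v b := (hn b).2 (by simp)
  obtain ⟨p, hp, e1, e2, e3⟩ := hG.trans h ha h1 h hb h2
  have hpa : p a ≠ a := fun e => h3 (e.symm.trans e3)
  refine ⟨p, hp, e1, e2, fun e => hpa (by rw [e]; rfl), ?_⟩
  exact hG.trivial h ha h1 (mul_mem hp hp) (by rw [aut_mul_apply, e1, e1])
    (by rw [aut_mul_apply, e2, e2])
    (hc.mul_fix_of_moves e2 e2 h.symm ha e1 e1 hpa hpa)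

theorem moves_of_ne_one (hG : IsTwoRegular X G) {u v w : V} (h : X.Adj u v) (h' : X.Adj v w)
    (hne : u ≠ w) {p : X ≃g X} (hp : p ∈ G) (hp1 : p ≠ 1) (hu : p u = u) (hv : p v = v) :
    p w ≠ w := fun e => hp1 (hG.trivial h h' hne hp hu hv e)

/-- The stabilizer of an arc has order two. -/
theorem flip_unique (hG : IsTwoRegular X G) (hc : IsCubic X) {u v : V} (h : X.Adj u v)
    {p y : X ≃g X} (hp : p ∈ G) (hy : y ∈ G) (hp1 : p ≠ 1) (hy1 : y ≠ 1) (hpu : p u = u)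
    (hpv : p v = v) (hyu : y u = u) (hyv : y v = v) : y = p := by
  obtain ⟨w, h1, h2⟩ := hc.exists_ne u v
  have e := hc.apply_eq_of_moves hpv hyv h.symm h1 hpu hyu
    (hG.moves_of_ne_one h h1 h2.symm hp hp1 hpu hpv)
    (hG.moves_of_ne_one h h1 h2.symm hy hy1 hyu hyv)
  have := hG.trivial h h1 h2.symm (mul_mem (inv_mem hy) hp)
    (by rw [aut_mul_apply, hpu, aut_inv_fix hyu]) (by rw [aut_mul_apply, hpv, aut_inv_fix hyv])
    (by rw [aut_mul_apply, e, aut_inv_apply_self])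
  exact (inv_mul_eq_one.1 this)

/-- The conjugate is a flip of the image arc, and that flip is unique. -/
theorem flip_conj (hG : IsTwoRegular X G) (hc : IsCubic X) {u v u' v' : V}
    (h' : X.Adj u' v') {p p' g : X ≃g X} (hp : p ∈ G) (hp' : p' ∈ G) (hp1 : p ≠ 1)
    (hp1' : p' ≠ 1) (hpu : p u = u) (hpv : p v = v) (hpu' : p' u' = u') (hpv' : p' v' = v')
    (hg : g ∈ G) (hgu : g u = u') (hgv : g v = v') : g * p * g⁻¹ = p' := by
  refine hG.flip_unique hc h' hp' (mul_mem (mul_mem hg hp) (inv_mem hg)) hp1' ?_ hpu' hpv' ?_ ?_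
  · exact fun e => hp1 (conj_eq_one_iff.1 e)
  · rw [aut_mul_apply, aut_mul_apply, ← hgu, aut_inv_apply_self, hpu]
  · rw [aut_mul_apply, aut_mul_apply, ← hgv, aut_inv_apply_self, hpv]

theorem flip_sign (hG : IsTwoRegular X G) (hc : IsCubic X) (σ : (X ≃g X) →* ℤˣ) {u v u' v' : V}
    (h : X.Adj u v) (h' : X.Adj u' v') {p p' : X ≃g X} (hp : p ∈ G) (hp' : p' ∈ G) (hp1 : p ≠ 1)
    (hp1' : p' ≠ 1) (hpu : p u = u) (hpv : p v = v) (hpu' : p' u' = u') (hpv' : p' v' = v') :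
    σ p' = σ p := by
  obtain ⟨g, hg, e1, e2⟩ := hG.arc_trans hc h h'
  rw [← hG.flip_conj hc h' hp hp' hp1 hp1' hpu hpv hpu' hpv' hg e1 e2, map_mul, map_mul, map_inv,
    mul_inv_cancel_comm]

/-- An element fixing a vertex fixes a neighbour or has order dividing three. -/
theorem fix_vertex (hG : IsTwoRegular X G) (hc : IsCubic X) {v : V} {y : X ≃g X} (hy : y ∈ G)
    (hv : y v = v) : (∃ w, X.Adj v w ∧ y w = w) ∨ y ^ 3 = 1 := by
  by_cases hex : ∃ w, X.Adj v w ∧ y w = w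
  · exact Or.inl hex
  right
  push Not at hex
  obtain ⟨a, b, c, h1, h2, h3, hn⟩ := hc.exists_neighbors v
  have ha : X.Adj v a := (hn a).2 (by simp)
  have hb : X.Adj v b := (hn b).2 (by simp)
  have hcc : X.Adj v c := (hn c).2 (by simp)
  have na := hex a ha
  have nb := hex b hb
  have nc := hex c hcc
  have ia : y a = a ∨ y a = b ∨ y a = c := by rw [← hn, ← hv]; exact aut_adj y (hv.symm ▸ ha)
  have ib : y b = a ∨ y b = b ∨ y b = c := by rw [← hn, ← hv]; exact aut_adj y (hv.symm ▸ hb)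
  have ic : y c = a ∨ y c = b ∨ y c = c := by rw [← hn, ← hv]; exact aut_adj y (hv.symm ▸ hcc)
  have jab : y a ≠ y b := aut_ne h1
  have jac : y a ≠ y c := aut_ne h2
  have jbc : y b ≠ y c := aut_ne h3
  have e3 : ∀ t, (y ^ 3) t = y (y (y t)) := fun t => rfl
  refine hG.trivial ha.symm hb h1 (pow_mem hy 3) ?_ (by rw [e3, hv, hv, hv]) ?_
  · rw [e3]
    grind
  · rw [e3]
    grind

theorem eq_one_of_units_pow_three {e : ℤˣ} (h : e ^ 3 = 1) : e = 1 := by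
  rcases Int.units_eq_one_or e with rfl | rfl
  · rfl
  · exact absurd h (by decide)

/-- If the elements fixing arcs are even, so are the elements fixing vertices. -/
theorem even_of_fix_vertex (hG : IsTwoRegular X G) (hc : IsCubic X) (σ : (X ≃g X) →* ℤˣ) {u v : V}
    (h : X.Adj u v) {p : X ≃g X} (hp : p ∈ G) (hp1 : p ≠ 1) (hpu : p u = u) (hpv : p v = v)
    (hσ : σ p = 1) {w : V} {y : X ≃g X} (hy : y ∈ G) (hw : y w = w) : σ y = 1 := by
  by_cases hy1 : y = 1
  · rw [hy1, map_one]
  rcases hG.fix_vertex hc hy hw with ⟨t, h1, h2⟩ | h3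
  · rw [hG.flip_sign hc σ h h1 hp hy hp1 hy1 hpu hpv hw h2, hσ]
  · apply eq_one_of_units_pow_three
    rw [← map_pow, h3, map_one]

theorem lineTrans (hG : IsTwoRegular X G) : LineTrans X 2 := by
  intro f f' hf hf'
  obtain ⟨g, -, e1, e2, e3⟩ := hG.trans (hf.adj_of_eq (i := 0) (j := 1) (by norm_num))
    (hf.adj_of_eq (i := 1) (j := 2) (by norm_num)) (hf.ne_of_eq (by norm_num))
    (hf'.adj_of_eq (i := 0) (j := 1) (by norm_num))
    (hf'.adj_of_eq (i := 1) (j := 2) (by norm_num)) (hf'.ne_of_eq (by norm_num))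
  refine ⟨g, fun i h0 h2 => ?_⟩
  have : i = 0 ∨ i = 1 ∨ i = 2 := by push_cast at h2; omega
  rcases this with rfl | rfl | rfl <;> assumption

end IsTwoRegular

/-- The line swept out by a shunt. -/
theorem IsLine.of_zpow {g : X ≃g X} {u : V} (h1 : X.Adj u (g u)) (h2 : u ≠ g (g u)) :
    IsLine X (fun i : ℤ => (g ^ i) u) := by
  intro i
  constructor
  · change X.Adj ((g ^ i) u) ((g ^ (i + 1)) u)
    rw [zpow_add_one, aut_mul_apply]
    exact aut_adj _ h1
  · change (g ^ i) u ≠ (g ^ (i + 2)) u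
    rw [zpow_add, aut_mul_apply]
    exact aut_ne h2

/-- A rigid `s`-arc-transitive cubic graph has a shunt system. -/
theorem IsCubic.exists_shuntSystem [Nonempty V] (hc : IsCubic X) {s : ℕ} (hs : 2 ≤ s)
    (ht : LineTrans X s) (hr : ∀ f, IsLine X f → ∀ x : X ≃g X, FixSeg f 0 s x → x = 1) :
    ∃ (v : ℤ → V) (x : ℤ → X ≃g X), ShuntSystem X s v x ∧
      ∀ (σ : (X ≃g X) →* ℤˣ) (i j : ℤ), σ (x i) = σ (x j) := by
  obtain ⟨u⟩ := ‹Nonempty V›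
  obtain ⟨a, b, c, hab, -, -, hn⟩ := hc.exists_neighbors u
  obtain ⟨f, hf, -⟩ := hc.exists_line ((hn a).2 (by simp)).symm ((hn b).2 (by simp)) hab
  -- The shunt: it moves an `s`-arc one step along itself.
  obtain ⟨g, hg⟩ := ht f _ hf (hf.shift 1)
  have e0 : g (f 0) = f 1 := hg 0 le_rfl (by omega)
  have e1 : g (f 1) = f 2 := hg 1 (by norm_num) (by omega)
  have hv : IsLine X (fun i : ℤ => (g ^ i) (f 0)) := IsLine.of_zpow
    (by rw [e0]; exact hf.adj_of_eq (by norm_num)) (by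
      rw [e0, e1]
      exact hf.ne_of_eq (by norm_num))
  have hgv : ∀ k i : ℤ, (g ^ k) ((g ^ i) (f 0)) = (g ^ (k + i)) (f 0) := fun k i => by
    rw [zpow_add, aut_mul_apply]
  obtain ⟨v, rfl⟩ : ∃ v : ℤ → V, v = fun i : ℤ => (g ^ i) (f 0) := ⟨_, rfl⟩
  -- `w` is the third neighbour of the vertex of index `s - 1`. Turning there to `w` gives an
  -- element `y` fixing the vertices `0, …, s - 1` and moving the next; its conjugates by powers of
  -- `g` are the `x i`.
  obtain ⟨w, w1, w2, w3⟩ := hc.exists_ne_ne ((g ^ ((s : ℤ) - 1 - 1)) (f 0)) ((g ^ (s : ℤ)) (f 0))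
    ((g ^ ((s : ℤ) - 1)) (f 0))
  obtain ⟨f', hf', k1, k2⟩ := hc.exists_line_modify hv (s - 1) w1 w2
  rw [sub_add_cancel] at k2
  obtain ⟨y, hy⟩ := ht _ f' hv hf'
  have hyfix : FixSeg (fun i : ℤ => (g ^ i) (f 0)) 0 (s - 1) y := fun k h0 h1 => by
    rw [hy k h0 (by omega), k1 k h1]
  have hy1 : y ≠ 1 := by
    rintro rfl
    have := hy s (by omega) le_rfl
    rw [k2] at this
    exact w3 this.symm
  have hx : ∀ i k : ℤ, g ^ (i + k) * y * g ^ (-(i + k)) =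
      MulAut.conj (g ^ k) (g ^ i * y * g ^ (-i)) := fun i k => by
    rw [MulAut.conj_apply]
    group
  refine ⟨_, fun i => g ^ i * y * g ^ (-i), ⟨hv, ?_, ?_, ?_, ?_⟩, ?_⟩
  · intro i z hz
    exact hr _ (hv.shift i) z fun k h0 h1 => hz _ (by omega) (by omega)
  · intro i k h0 h1
    change (g ^ i * y * g ^ (-i)) ((g ^ k) (f 0)) = (g ^ k) (f 0)
    rw [aut_mul_apply, aut_mul_apply, hgv]
    have := hyfix (-i + k) (by omega) (by omega)
    simp only at this
    rw [this, hgv]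
    congr 2
    ring
  · intro i h
    rw [zpow_neg] at h
    exact hy1 (conj_eq_one_iff.1 h)
  · intro i j k h
    rw [hx, hx]
    exact h.map (MulAut.conj (g ^ k))
  · intro σ i j
    simp only [map_mul, zpow_neg, map_inv, mul_inv_cancel_comm]

/-- A `2`-regular group in which the involutions fixing arcs are odd for some sign character of
the automorphism group is the full automorphism group. -/
theorem IsTwoRegular.eq_top_of_odd [Finite V] {G : Subgroup (X ≃g X)} (hG : IsTwoRegular X G)
    (hc : IsCubic X) (hconn : X.Connected) (σ : (X ≃g X) →* ℤˣ) {u v : V} (h : X.Adj u v)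
    {p : X ≃g X} (hp : p ∈ G) (hp1 : p ≠ 1) (hpu : p u = u) (hpv : p v = v) (hσ : σ p = -1) :
    G = ⊤ := by
  have := hconn.nonempty
  obtain ⟨s, hs, ht, hr⟩ := hc.exists_lineTrans_rigid hconn hG.lineTrans
  rcases hs.lt_or_eq with hs | rfl
  · exfalso
    obtain ⟨v, x, S, hx⟩ := hc.exists_shuntSystem hs.le ht hr
    have a1 : X.Adj (v (s - 3)) (v (s - 2)) := S.line.adj_of_eq (by ring)
    have a2 : X.Adj (v (s - 2)) (v (s - 1)) := S.line.adj_of_eq (by ring)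
    have a3 : X.Adj (v (s - 1)) (v s) := S.line.adj_of_eq (by ring)
    obtain ⟨q, hq, e1, e2, hq1, hq2⟩ := hG.exists_flip hc a2
    refine S.false_of_odd hc hconn (by omega) σ hq2 ?_ (hx σ) ?_ ?_ ?_ (p := q)
    · rw [hG.flip_sign hc σ h a2 hp hq hp1 hq1 hpu hpv e1 e2, hσ]
    · intro k h1 h2
      have : k = s - 2 ∨ k = s - 1 := by omega
      rcases this with rfl | rfl <;> assumption
    · exact hG.moves_of_ne_one a2.symm a1.symm (S.line.ne_of_eq (by ring)).symm hq hq1 e2 e1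
    · exact hG.moves_of_ne_one a2 a3 (S.line.ne_of_eq (by ring)) hq hq1 e1 e2
  -- For `s = 2` the full group is also regular on 2-arcs.
  · rw [eq_top_iff]
    intro g _
    obtain ⟨w, h1, h2⟩ := hc.exists_ne u v
    obtain ⟨g', hg', e1, e2, e3⟩ := hG.trans h h1 h2.symm (aut_adj g h) (aut_adj g h1)
      (aut_ne h2.symm)
    obtain ⟨f, hf, f0, f1, f2⟩ := hc.exists_line h h1 h2.symm
    have : g'⁻¹ * g = 1 := by
      apply hr f hf
      intro k k0 k2
      have : k = 0 ∨ k = 1 ∨ k = 2 := by push_cast at k2; omega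
      rcases this with rfl | rfl | rfl
      · rw [f0, aut_mul_apply, ← e1, aut_inv_apply_self]
      · rw [f1, aut_mul_apply, ← e2, aut_inv_apply_self]
      · rw [f2, aut_mul_apply, ← e3, aut_inv_apply_self]
    rw [← inv_mul_eq_one.1 this]
    exact hg'

end TwoRegular

/-! ### Signs of involutions and of semiregular automorphisms -/

section Sign

variable {V : Type*} [Fintype V] [DecidableEq V] {X : SimpleGraph V}

/-- The sign of an automorphism as a permutation of the vertices. -/
def autSign (X : SimpleGraph V) : (X ≃g X) →* ℤˣ where
  toFun g := Equiv.Perm.sign (g.toEquiv : Equiv.Perm V)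
  map_one' := Equiv.Perm.sign_one
  map_mul' g h := Equiv.Perm.sign_mul (g.toEquiv : Equiv.Perm V) h.toEquiv

theorem sign_of_cycleType_eq_replicate {σ : Equiv.Perm V} {r d : ℕ}
    (h : σ.cycleType = Multiset.replicate r d) :
    σ.support.card = r * d ∧ Equiv.Perm.sign σ = (-1) ^ (r * d + r) := by
  constructor
  · rw [← Equiv.Perm.sum_cycleType, h]
    simp
  · rw [Equiv.Perm.sign_of_cycleType, h]
    simp

/-- The sign of an involution. -/
theorem exists_sign_involution {g : X ≃g X} (h : g * g = 1) :
    ∃ r : ℕ, Fintype.card V = Fintype.card {v // g v = v} + 2 * r ∧ autSign X g = (-1) ^ r := by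
  have h2 : (g.toEquiv : Equiv.Perm V) ^ 2 = 1 := by
    ext v
    exact DFunLike.congr_fun h v
  have h3 := sign_of_cycleType_eq_replicate (Equiv.Perm.cycleType_of_pow_prime_eq_one h2)
  refine ⟨(Equiv.Perm.cycleType (g.toEquiv : Equiv.Perm V)).card, ?_, ?_⟩
  rotate_left
  · change Equiv.Perm.sign (g.toEquiv : Equiv.Perm V) = _
    rw [h3.2, show ∀ t : ℕ, t * 2 + t = t + 2 * t by intro t; ring, pow_add, pow_mul]
    simp
  · rw [mul_comm 2, ← h3.1, Fintype.card_subtype, ← Finset.card_univ,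
      ← Finset.card_filter_add_card_filter_not (p := fun v => g v = v)]
    congr 2

/-- There are `|V| / 2` transpositions, an even number. -/
theorem even_of_fixedPointFree {g : X ≃g X} (h : g * g = 1) (hf : ∀ v, g v ≠ v)
    (h4 : 4 ∣ Fintype.card V) : autSign X g = 1 := by
  obtain ⟨r, h1, h2⟩ := exists_sign_involution h
  have : IsEmpty {v // g v = v} := ⟨fun v => hf v.1 v.2⟩
  rw [Fintype.card_eq_zero (α := {v // g v = v})] at h1
  rw [h2, Even.neg_one_pow]
  rw [even_iff_two_dvd]
  omega

/-- A semiregular automorphism with an odd number of cycles, all of the same even length, is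
odd. -/
theorem odd_of_semiregular {g : X ≃g X} {d m : ℕ} (hd : Even d) (hm : Odd m)
    (hcard : Fintype.card V = d * m) (hg : orderOf g = d) (hgd : g ≠ 1)
    (hreg : ∀ (i : ℕ) v, (g ^ i) v = v → g ^ i = 1) : autSign X g = -1 := by
  have hpow : ∀ (i : ℕ) (v : V), ((g.toEquiv : Equiv.Perm V) ^ i) v = (g ^ i) v := by
    intro i
    induction i with
    | zero => intro v; rfl
    | succ i ih =>
      intro v
      rw [pow_succ, pow_succ]
      exact ih (g v)
  -- The `n`-th power fixes the points of a cycle of length `n`, so by semiregularity it is trivial.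
  have hct : ∀ n ∈ Equiv.Perm.cycleType (g.toEquiv : Equiv.Perm V), n = d := by
    intro n hn
    obtain ⟨c, τ, h1, h2, h3, h4⟩ := Equiv.Perm.mem_cycleType_iff.1 hn
    obtain ⟨v, hv⟩ := h3.nonempty_support
    have h5 : τ v = v := by
      rcases h2 v with h | h
      · exact absurd h (Equiv.Perm.mem_support.1 hv)
      · exact h
    have h6 : (g ^ n) v = v := by
      rw [← hpow, h1, h2.commute.mul_pow, ← h4, ← h3.orderOf, pow_orderOf_eq_one, one_mul]
      exact Equiv.Perm.pow_apply_eq_self_of_apply_eq_self h5 _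
    have h7 := orderOf_dvd_of_pow_eq_one (hreg n v h6)
    rw [hg] at h7
    refine Nat.dvd_antisymm ?_ h7
    have h8 : (g.toEquiv : Equiv.Perm V) ^ d = 1 := by
      ext v
      rw [hpow, ← hg, pow_orderOf_eq_one]
      rfl
    exact (Equiv.Perm.dvd_of_mem_cycleType hn).trans (orderOf_dvd_of_pow_eq_one h8)
  have h9 := sign_of_cycleType_eq_replicate (Multiset.eq_replicate_card.2 hct)
  have hsupp : Equiv.Perm.support (g.toEquiv : Equiv.Perm V) = Finset.univ := by
    rw [Finset.eq_univ_iff_forall]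
    intro v
    rw [Equiv.Perm.mem_support]
    exact fun h => hgd (by simpa using hreg 1 v (by simpa using h))
  rw [hsupp, Finset.card_univ, hcard, mul_comm] at h9
  have hd0 : 0 < d := hg ▸ orderOf_pos_iff.2 (by
    have : Finite (X ≃g X) := Finite.of_injective _ RelIso.toEquiv_injective
    exact isOfFinOrder_of_finite g)
  rw [← Nat.eq_of_mul_eq_mul_right hd0 h9.1] at h9
  change Equiv.Perm.sign (g.toEquiv : Equiv.Perm V) = -1
  rw [h9.2]
  exact ((hd.mul_left m).add_odd hm).neg_one_pow

end Sign

/-! ### 2-groups with an involution of small centralizer -/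

section TwoGroup

theorem exists_eq_of_card_eq_two {Q : Type*} [Group Q] {Z : Subgroup Q} (h : Nat.card Z = 2) :
    ∃ z, z ≠ 1 ∧ z ∈ Z ∧ ∀ y ∈ Z, y = 1 ∨ y = z := by
  obtain ⟨a, b, hab, hu⟩ := Nat.card_eq_two_iff.1 h
  have key : ∀ y : Z, y = a ∨ y = b := fun y => by
    have : y ∈ ({a, b} : Set Z) := hu ▸ Set.mem_univ y
    simpa using this
  rcases key 1 with h1 | h1
  · refine ⟨b, fun e => hab ?_, b.2, fun y hy => ?_⟩
    · rw [← h1]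
      exact Subtype.ext e.symm
    · rcases key ⟨y, hy⟩ with h | h
      · left
        have := congrArg Subtype.val (h.trans h1.symm)
        exact this
      · right
        exact congrArg Subtype.val h
  · refine ⟨a, fun e => hab ?_, a.2, fun y hy => ?_⟩
    · rw [← h1]
      exact Subtype.ext e
    · rcases key ⟨y, hy⟩ with h | h
      · right
        exact congrArg Subtype.val h
      · left
        have := congrArg Subtype.val (h.trans h1.symm)
        exact this

/-- A finite `2`-group of order `2 ^ (k + 1)` with an involution whose centralizer has order at
most four has a cyclic subgroup of index two. -/
theorem exists_orderOf_eq_of_card_centralizer_le (k : ℕ) (hk : 2 ≤ k) :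
    ∀ (Q : Type*) [Group Q], Nat.card Q = 2 ^ (k + 1) → ∀ p : Q, p * p = 1 → p ≠ 1 →
      Nat.card (Subgroup.centralizer {p}) ≤ 4 → ∃ c : Q, orderOf c = 2 ^ k := by
  induction k, hk using Nat.le_induction with
  | base =>
    intro Q _ hQ p hp hp1 hC
    have : Finite Q := Nat.finite_of_card_ne_zero (by rw [hQ]; norm_num)
    by_contra hcon
    push Not at hcon
    -- otherwise the group would have exponent two
    have hexp : ∀ c : Q, c * c = 1 := by
      intro c
      have hd : orderOf c ∣ 2 ^ 3 := hQ ▸ orderOf_dvd_natCard c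
      obtain ⟨i, hi, hi'⟩ := (Nat.dvd_prime_pow Nat.prime_two).1 hd
      have hi4 : i ≤ 1 := by
        by_contra h
        have : i = 2 ∨ i = 3 := by omega
        rcases this with rfl | rfl
        · exact hcon c hi'
        · apply hcon (c ^ 2)
          rw [orderOf_pow, hi']
          norm_num
      rw [← pow_two]
      apply orderOf_dvd_iff_pow_eq_one.1
      rw [hi']
      exact pow_dvd_pow 2 hi4 |>.trans (by norm_num)
    have hinv : ∀ c : Q, c⁻¹ = c := fun c => inv_eq_of_mul_eq_one_left (hexp c)
    have htop : Subgroup.centralizer {p} = (⊤ : Subgroup Q) := by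
      rw [eq_top_iff]
      intro c _
      rw [Subgroup.mem_centralizer_singleton_iff]
      calc c * p = (c * p)⁻¹ := (hinv _).symm
        _ = p * c := by rw [mul_inv_rev, hinv, hinv]
    rw [htop, Subgroup.card_top, hQ] at hC
    norm_num at hC
  | succ k hk ih =>
    intro Q _ hQ p hp hp1 hC
    have : Finite Q := Nat.finite_of_card_ne_zero (by rw [hQ]; positivity)
    have hpg : IsPGroup 2 Q := IsPGroup.of_card hQ
    have : Nontrivial Q := ⟨⟨p, 1, hp1⟩⟩
    have hfact : Fact (Nat.Prime 2) := ⟨Nat.prime_two⟩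
    have hbig : 16 ≤ Nat.card Q := by
      rw [hQ]
      exact (by norm_num : 16 = 2 ^ 4).le.trans (Nat.pow_le_pow_right (by norm_num) (by omega))
    let Z := Subgroup.center Q
    have hpZ : p ∉ Z := by
      intro h
      have htop : Subgroup.centralizer {p} = (⊤ : Subgroup Q) := by
        rw [eq_top_iff]
        intro c _
        rw [Subgroup.mem_centralizer_singleton_iff]
        exact Subgroup.mem_center_iff.1 h c
      rw [htop, Subgroup.card_top] at hC
      omega
    have hZC : Z < Subgroup.centralizer {p} := by
      refine lt_of_le_of_ne (fun z hz => ?_) (fun e => hpZ ?_)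
      · rw [Subgroup.mem_centralizer_singleton_iff]
        exact (Subgroup.mem_center_iff.1 hz p).symm
      · rw [e, Subgroup.mem_centralizer_singleton_iff]
    have hZ2 : Nat.card Z = 2 := by
      -- The centre is nontrivial, and proper in a group of order at most 4.
      have h1 : Nat.card Z < Nat.card (Subgroup.centralizer {p}) :=
        Set.ncard_lt_ncard (s := (Z : Set Q)) hZC (Set.toFinite _)
      have h2 : 1 < Nat.card Z := by
        have := hpg.center_nontrivial
        exact Finite.one_lt_card
      have h3 : Nat.card Z ∣ 2 ^ (k + 1 + 1) := hQ ▸ Subgroup.card_subgroup_dvd_card Z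
      obtain ⟨i, -, hi⟩ := (Nat.dvd_prime_pow Nat.prime_two).1 h3
      have : i < 2 := by
        by_contra h
        have : 2 ^ 2 ≤ 2 ^ i := Nat.pow_le_pow_right (by norm_num) (by omega)
        omega
      interval_cases i <;> omega
    obtain ⟨z, hz1, hzZ, hz⟩ := exists_eq_of_card_eq_two hZ2
    have hzz : z * z = 1 := by
      rcases hz (z * z) (mul_mem hzZ hzZ) with h | h
      · exact h
      · exact absurd (by simpa using h) hz1
    have hQZ : Nat.card (Q ⧸ Z) = 2 ^ (k + 1) := by
      have := Subgroup.card_eq_card_quotient_mul_card_subgroup Z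
      rw [hQ, hZ2, pow_succ] at this
      omega
    let π := QuotientGroup.mk' Z
    have hπ : ∀ y : Q, π y = 1 ↔ y ∈ Z := fun y => QuotientGroup.eq_one_iff y
    have hπs : Function.Surjective π := QuotientGroup.mk'_surjective Z
    -- the centralizer of the image of `p` is not larger
    have hCq : Nat.card (Subgroup.centralizer {π p}) ≤ 4 := by
      let D := (Subgroup.centralizer {π p}).comap π
      have hD : Nat.card D = Nat.card (Subgroup.centralizer {π p}) * 2 := by
        have h1 := Subgroup.card_mul_index D
        have h2 := Subgroup.card_mul_index (Subgroup.centralizer {π p})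
        rw [Subgroup.index_comap_of_surjective _ hπs, hQ] at h1
        rw [hQZ] at h2
        rw [pow_succ, ← h2, mul_right_comm] at h1
        exact Nat.eq_of_mul_eq_mul_right (Nat.pos_of_ne_zero Subgroup.index_ne_zero_of_finite) h1
      have hDC : Nat.card D ≤ Nat.card (Subgroup.centralizer {p}) * 2 := by
        -- the commutator with `p` takes at most two values on `D`
        by_cases hex : ∃ d ∈ D, d * p = z * (p * d)
        · obtain ⟨d, -, hd⟩ := hex
          have hinj : ∀ y : D, ∃ c : Subgroup.centralizer {p} × Bool,
              (y : Q) = d ^ (if c.2 then 1 else 0) * c.1 := by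
            intro y
            have hy := Subgroup.mem_centralizer_singleton_iff.1 (Subgroup.mem_comap.1 y.2)
            have hy1 : π ((y : Q) * p * (p * y)⁻¹) = 1 := by
              rw [map_mul, map_inv, map_mul, map_mul, hy, mul_inv_cancel]
            have hzc := fun t => Subgroup.mem_center_iff.1 hzZ t
            rcases hz _ ((hπ _).1 hy1) with h | h
            · refine ⟨⟨⟨y, Subgroup.mem_centralizer_singleton_iff.2 ?_⟩, false⟩, by simp⟩
              exact mul_inv_eq_one.1 h
            · have h' : (y : Q) * p = z * (p * y) := mul_inv_eq_iff_eq_mul.1 h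
              refine ⟨⟨⟨d⁻¹ * y, Subgroup.mem_centralizer_singleton_iff.2 ?_⟩, true⟩, by simp⟩
              have hd' : d⁻¹ * z * p = p * d⁻¹ := by
                rw [mul_assoc, inv_mul_eq_iff_eq_mul, ← mul_assoc, hd]
                group
              rw [mul_assoc, h', ← mul_assoc, ← mul_assoc, hd', mul_assoc]
          choose F hF using hinj
          have hFi : Function.Injective F := fun a b hab => by
            apply Subtype.ext
            rw [hF a, hF b, hab]
          have := Nat.card_le_card_of_injective F hFi
          rw [Nat.card_prod] at this
          simpa using this
        · push Not at hex
          have hle : D ≤ Subgroup.centralizer {p} := by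
            intro y hyD
            have hy := Subgroup.mem_centralizer_singleton_iff.1 (Subgroup.mem_comap.1 hyD)
            have hy1 : π ((y : Q) * p * (p * y)⁻¹) = 1 := by
              rw [map_mul, map_inv, map_mul, map_mul, hy, mul_inv_cancel]
            rcases hz _ ((hπ _).1 hy1) with h | h
            · exact Subgroup.mem_centralizer_singleton_iff.2 (mul_inv_eq_one.1 h)
            · exact absurd (mul_inv_eq_iff_eq_mul.1 h) (hex y hyD)
          have := Nat.card_le_card_of_injective _ (Subgroup.inclusion_injective hle)
          omega
      omega
    obtain ⟨cq, hcq⟩ := ih (Q ⧸ Z) hQZ (π p) (by rw [← map_mul, hp, map_one])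
      (fun h => hpZ ((hπ p).1 h)) hCq
    obtain ⟨c, rfl⟩ := hπs cq
    have hdvd : 2 ^ k ∣ orderOf c := hcq ▸ orderOf_map_dvd π c
    have hcZ : c ^ 2 ^ k ∈ Z := by
      rw [← hπ, map_pow, ← hcq, pow_orderOf_eq_one]
    -- If this power is not 1, it is the central involution, and `c` already has the required order.
    by_cases hc1 : c ^ 2 ^ k = 1
    swap
    · refine ⟨c, ?_⟩
      apply orderOf_eq_prime_pow hc1
      rw [pow_succ, pow_mul, pow_two]
      rcases hz _ hcZ with h | h
      · rw [h, one_mul]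
      · rw [h, hzz]
    exfalso
    have hoc : orderOf c = 2 ^ k := Nat.dvd_antisymm (orderOf_dvd_of_pow_eq_one hc1) hdvd
    -- the preimage of the cyclic subgroup has index two, hence is normal
    let C := (Subgroup.zpowers (π c)).comap π
    have hCidx : C.index = 2 := by
      rw [Subgroup.index_comap_of_surjective _ hπs]
      have h1 := Subgroup.card_mul_index (Subgroup.zpowers (π c))
      rw [Nat.card_zpowers, hcq, hQZ, pow_succ] at h1
      exact Nat.eq_of_mul_eq_mul_left (by positivity) h1
    have hCn : C.Normal := Subgroup.normal_of_index_eq_two hCidx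
    have hcC : c ∈ C := Subgroup.mem_comap.2 (Subgroup.mem_zpowers _)
    -- The involution of `⟨c⟩`. It will turn out central, so that its image is trivial, against the
    -- order of `π c`.
    obtain ⟨w, hw⟩ : ∃ w, w = c ^ 2 ^ (k - 1) := ⟨_, rfl⟩
    have hk1 : 2 ^ k = 2 ^ (k - 1) * 2 := by
      rw [← pow_succ]
      congr 1
      omega
    have hw1 : w ≠ 1 := by
      intro h
      rw [hw] at h
      have := Nat.le_of_dvd (by positivity) (hoc ▸ orderOf_dvd_of_pow_eq_one h)
      have := Nat.pow_lt_pow_right (a := 2) (by norm_num) (show k - 1 < k by omega)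
      omega
    have hww : w * w = 1 := by rw [hw, ← pow_two, ← pow_mul, ← hk1, hc1]
    have hwZ : w ∈ Z := by
      rw [Subgroup.mem_center_iff]
      intro g
      have h1 : g * c * g⁻¹ ∈ C := hCn.conj_mem c hcC g
      obtain ⟨i, hi⟩ := Subgroup.mem_zpowers_iff.1 (Subgroup.mem_comap.1 h1)
      have h2 : (c ^ i)⁻¹ * (g * c * g⁻¹) ∈ Z := by
        rw [← hπ, map_mul, ← hi, map_inv, map_zpow, inv_mul_cancel]
      obtain ⟨y, hy⟩ : ∃ y, y = (c ^ i)⁻¹ * (g * c * g⁻¹) := ⟨_, rfl⟩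
      rw [← hy] at h2
      have h3 : g * c * g⁻¹ = c ^ i * y := by rw [hy, mul_inv_cancel_left]
      -- The central factor disappears because `k ≥ 2` makes the exponent even.
      have hyy : y ^ 2 ^ (k - 1) = 1 := by
        have hy2 : y ^ 2 = 1 := by
          rcases hz y h2 with h | h
          · rw [h, one_pow]
          · rw [h, pow_two, hzz]
        rw [show k - 1 = k - 2 + 1 by omega, pow_succ, mul_comm, pow_mul, hy2, one_pow]
      have h4 : g * w * g⁻¹ = w ^ i := by
        have hcomm : Commute (c ^ i) y := Subgroup.mem_center_iff.1 h2 _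
        rw [hw, ← conj_pow, h3, hcomm.mul_pow, hyy, mul_one, ← zpow_natCast, ← zpow_mul,
          mul_comm, zpow_mul, zpow_natCast]
      have h5 : g * w * g⁻¹ = w := by
        rcases Int.even_or_odd' i with ⟨j, rfl | rfl⟩
        · rw [zpow_mul, show (2 : ℤ) = ((2 : ℕ) : ℤ) from rfl, zpow_natCast, pow_two, hww,
            one_zpow] at h4
          exact absurd (conj_eq_one_iff.1 h4) hw1
        · rw [h4, zpow_add, zpow_mul, show (2 : ℤ) = ((2 : ℕ) : ℤ) from rfl, zpow_natCast,
            pow_two, hww, one_zpow, one_mul, zpow_one]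
      rw [mul_inv_eq_iff_eq_mul] at h5
      exact h5
    have hπw := (hπ w).2 hwZ
    rw [hw, map_pow] at hπw
    have := Nat.le_of_dvd (by positivity) (hcq ▸ orderOf_dvd_of_pow_eq_one hπw)
    have := Nat.pow_lt_pow_right (a := 2) (by norm_num) (show k - 1 < k by omega)
    omega

end TwoGroup

/-! ### The classes that occur when flips are odd -/

section Classes

variable {V : Type*} {X : SimpleGraph V}

/-- A group of automorphisms of a connected graph that contains a transitive action on the
neighbours of `v` and an element moving `v` to a neighbour is transitive on vertices. -/
theorem exists_mem_apply_eq (hconn : X.Connected) {L : Subgroup (X ≃g X)} {v : V} {a : X ≃g X}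
    (ha : a ∈ L) (hnb : ∀ x, X.Adj v x → ∃ y ∈ L, y v = v ∧ y (a v) = x) (u : V) :
    ∃ g ∈ L, g v = u := by
  have hstep : ∀ u w, X.Adj u w → (∃ g ∈ L, g v = u) → ∃ g ∈ L, g v = w := by
    rintro u w huw ⟨g, hg, rfl⟩
    have h1 := aut_adj g⁻¹ huw
    rw [aut_inv_apply_self] at h1
    obtain ⟨y, hy, -, h2⟩ := hnb _ h1
    refine ⟨g * y * a, mul_mem (mul_mem hg hy) ha, ?_⟩
    rw [aut_mul_apply, aut_mul_apply, h2, aut_apply_inv_self]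
  obtain ⟨q⟩ := hconn.preconnected v u
  have h0 : ∃ g ∈ L, g v = v := ⟨1, one_mem _, rfl⟩
  suffices ∀ t, X.Walk t u → (∃ g ∈ L, g v = t) → ∃ g ∈ L, g v = u from this v q h0
  intro t q h0
  induction q with
  | nil => exact h0
  | cons h q ih => exact ih q (hstep _ _ h h0)

/-- A group of automorphisms is contained in any group that contains a vertex stabilizer and is
transitive on vertices. -/
theorem le_of_stabilizer_le {H L : Subgroup (X ≃g X)} (hLH : L ≤ H) {v : V}
    (ht : ∀ u, ∃ g ∈ L, g v = u) (hs : ∀ g ∈ H, g v = v → g ∈ L) : H ≤ L := by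
  intro g hg
  obtain ⟨y, hy, h⟩ := ht (g v)
  have := hs (y⁻¹ * g) (mul_mem (inv_mem (hLH hy)) hg)
    (by rw [aut_mul_apply, ← h, aut_inv_apply_self])
  exact (Subgroup.mul_mem_cancel_left _ (inv_mem hy)).1 this

theorem two1_h_pow : (PresentedGroup.of (0 : Fin 3) : ArcClass.UnivGroup .two1) ^ 3 = 1 :=
  PresentedGroup.one_of_mem (rels := ArcClass.relators .two1)
    (x := FreeGroup.of (0 : Fin 3) ^ 3) (Or.inl rfl)

theorem two1_a_sq : (PresentedGroup.of (1 : Fin 3) : ArcClass.UnivGroup .two1) ^ 2 = 1 :=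
  PresentedGroup.one_of_mem (rels := ArcClass.relators .two1)
    (x := FreeGroup.of (1 : Fin 3) ^ 2) (Or.inr (Or.inl rfl))

theorem two1_p_sq : (PresentedGroup.of (2 : Fin 3) : ArcClass.UnivGroup .two1) ^ 2 = 1 :=
  PresentedGroup.one_of_mem (rels := ArcClass.relators .two1)
    (x := FreeGroup.of (2 : Fin 3) ^ 2) (Or.inr (Or.inr (Or.inl rfl)))

theorem two2_h_pow : (PresentedGroup.of (0 : Fin 3) : ArcClass.UnivGroup .two2) ^ 3 = 1 :=
  PresentedGroup.one_of_mem (rels := ArcClass.relators .two2)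
    (x := FreeGroup.of (0 : Fin 3) ^ 3) (Or.inl rfl)

theorem mem_rel22 {F : Type*} [Group F] (h a p : F) : a ^ 2 * p⁻¹ ∈ ArcClass.rel22 h a p :=
  Or.inr (Or.inr (Or.inl rfl))

theorem two2_a_sq : (PresentedGroup.of (1 : Fin 3) : ArcClass.UnivGroup .two2) ^ 2 =
    PresentedGroup.of (2 : Fin 3) :=
  (mul_inv_eq_one (G := ArcClass.UnivGroup .two2)).1
    (PresentedGroup.one_of_mem (rels := ArcClass.relators .two2)
      (mem_rel22 (F := FreeGroup (Fin 3)) _ _ _))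

/-- Elements `h, a, p` of `G` at an edge `{v, w}` that satisfy the relations of `G₂¹`, with `p`
odd for the sign character `σ`, and `h` and `a` even. -/
structure EdgeData (G : Subgroup (X ≃g X)) (σ : (X ≃g X) →* ℤˣ) (v w : V) (h a p : X ≃g X) :
    Prop where
  adj : X.Adj v w
  h_mem : h ∈ G
  a_mem : a ∈ G
  p_mem : p ∈ G
  h_pow : h ^ 3 = 1
  a_sq : a * a = 1
  p_sq : p * p = 1
  ap : a * p = p * a
  php : p * h * p = h⁻¹
  h_v : h v = v
  a_v : a v = w
  a_w : a w = v
  p_v : p v = v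
  p_w : p w = w
  p_ne : p ≠ 1
  h_even : σ h = 1
  a_even : σ a = 1
  p_odd : σ p = -1
  h_trans : ∀ x, X.Adj v x → ∃ i : ℕ, (h ^ i) w = x

/-- The square of an edge reversal fixes the arc and is even, so it cannot be the odd flip `p` and
must be 1. Multiplying by `p`, which commutes with it, makes the reversal even if necessary. The
rotation `h` is even because `h ^ 3 = 1`. -/
theorem IsTwoRegular.exists_edgeData {G : Subgroup (X ≃g X)} (hG : IsTwoRegular X G)
    (hc : IsCubic X) (σ : (X ≃g X) →* ℤˣ) {v w : V} (hvw : X.Adj v w) {p : X ≃g X} (hp : p ∈ G)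
    (hp1 : p ≠ 1) (hpv : p v = v) (hpw : p w = w) (hσ : σ p = -1) :
    ∃ h a, EdgeData G σ v w h a p := by
  obtain ⟨b, c, h1, h2, h3, hn⟩ := hc.exists_neighbors_of_adj hvw
  have hb : X.Adj v b := (hn b).2 (by simp)
  have hcc : X.Adj v c := (hn c).2 (by simp)
  -- `p` is an involution swapping `b` and `c`
  obtain ⟨p', hp', e1, e2, hp1', hsq⟩ := hG.exists_flip hc hvw
  obtain rfl := hG.flip_unique hc hvw hp hp' hp1 hp1' hpv hpw e1 e2
  have pb : p' b = c := by
    have k1 := hG.moves_of_ne_one hvw.symm hb h1 hp hp1 hpw hpv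
    have k2 := aut_adj p' hb
    rw [hpv, hn] at k2
    rcases k2 with k2 | k2 | k2
    · exact absurd (p'.injective (k2.trans hpw.symm)) h1.symm
    · exact absurd k2 k1
    · exact k2
  have pc : p' c = b := by rw [← pb, ← aut_mul_apply, hsq]; rfl
  -- the edge reversing element
  obtain ⟨u, hu1, hu2⟩ := hc.exists_ne v w
  obtain ⟨a, ha, av, aw⟩ := hG.arc_trans hc hvw hvw.symm
  have asq : a * a = 1 := by
    by_contra hne
    have : a * a = p' := hG.flip_unique hc hvw hp (mul_mem ha ha) hp1 hne hpv hpw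
      (by rw [aut_mul_apply, av, aw]) (by rw [aut_mul_apply, aw, av])
    rw [← this, map_mul, Int.units_mul_self] at hσ
    exact absurd hσ (by decide)
  have hap : a * p' = p' * a := by
    have := hG.flip_conj hc hvw.symm hp hp hp1 hp1 hpv hpw hpw hpv ha av aw
    exact mul_inv_eq_iff_eq_mul.1 this
  have hA : ∃ a ∈ G, a v = w ∧ a w = v ∧ a * a = 1 ∧ a * p' = p' * a ∧ σ a = 1 := by
    rcases Int.units_eq_one_or (σ a) with hs | hs
    · exact ⟨a, ha, av, aw, asq, hap, hs⟩
    · refine ⟨a * p', mul_mem ha hp, by rw [aut_mul_apply, hpv, av],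
        by rw [aut_mul_apply, hpw, aw], ?_, ?_, by rw [map_mul, hs, hσ]; decide⟩
      · calc a * p' * (a * p') = a * p' * (p' * a) := by rw [hap]
          _ = a * (p' * p') * a := by group
          _ = 1 := by rw [hsq, mul_one, asq]
      · rw [hap, mul_assoc, hap]
  obtain ⟨a, ha, av, aw, asq, hap, haσ⟩ := hA
  -- the rotation
  obtain ⟨h, hh, hw, hv, hhb⟩ := hG.trans hvw.symm hb h1 hb.symm hcc h3
  have hhc : h c = w := by
    have k2 := aut_adj h hcc
    rw [hv, hn] at k2
    rcases k2 with k2 | k2 | k2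
    · exact k2
    · exact absurd (h.injective (k2.trans hw.symm)) h2.symm
    · exact absurd (h.injective (k2.trans hhb.symm)) h3.symm
  have hh3 : h ^ 3 = 1 := by
    refine hG.trivial hvw.symm hb h1 (pow_mem hh 3) ?_ ?_ ?_
    · change h (h (h w)) = w
      rw [hw, hhb, hhc]
    · change h (h (h v)) = v
      rw [hv, hv, hv]
    · change h (h (h b)) = b
      rw [hhb, hhc, hw]
  refine ⟨h, a, hvw, hh, ha, hp, hh3, asq, hsq, hap, ?_, hv, av, aw, hpv, hpw, hp1, ?_, haσ, hσ,
    ?_⟩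
  · apply eq_inv_of_mul_eq_one_left
    refine hG.trivial hvw.symm hb h1 (mul_mem (mul_mem (mul_mem hp hh) hp) hh) ?_ ?_ ?_
    · simp only [aut_mul_apply, hw, pb, hhc, hpw]
    · simp only [aut_mul_apply, hv, hpv]
    · simp only [aut_mul_apply, hhb, pc]
  · apply IsTwoRegular.eq_one_of_units_pow_three
    rw [← map_pow, hh3, map_one]
  · intro x hx
    rcases (hn x).1 hx with rfl | rfl | rfl
    · exact ⟨0, rfl⟩
    · exact ⟨1, hw⟩
    · exact ⟨2, by rw [pow_two, aut_mul_apply, hw, hhb]⟩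

theorem isSArc_one_iff {f : Fin 2 → V} : IsSArc X 1 f ↔ X.Adj (f 0) (f 1) := by
  constructor
  · intro h
    exact h.1 0 1 (by simp)
  · intro h
    constructor
    · intro i j hij
      fin_cases i <;> fin_cases j <;> simp_all
    · intro i j hij
      fin_cases i <;> fin_cases j <;> simp_all

namespace EdgeData

variable {G : Subgroup (X ≃g X)} {σ : (X ≃g X) →* ℤˣ} {v w : V} {h a p : X ≃g X}

theorem transitive (D : EdgeData G σ v w h a p) (hconn : X.Connected) {L : Subgroup (X ≃g X)}
    (hh : h ∈ L) (ha : a ∈ L) (u : V) : ∃ g ∈ L, g v = u := by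
  refine exists_mem_apply_eq hconn ha (fun x hx => ?_) u
  obtain ⟨i, hi⟩ := D.h_trans x hx
  refine ⟨h ^ i, pow_mem hh i, ?_, by rw [D.a_v, hi]⟩
  clear hi
  induction i with
  | zero => rfl
  | succ i ih => rw [pow_succ, aut_mul_apply, D.h_v, ih]

/-- The stabilizer of `v` consists of the elements `hⁱ` and `hⁱ p`. -/
theorem stabilizer_eq (D : EdgeData G σ v w h a p) (hG : IsTwoRegular X G) (hc : IsCubic X)
    {g : X ≃g X} (hg : g ∈ G) (hv : g v = v) : ∃ i : ℕ, g = h ^ i ∨ g = h ^ i * p := by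
  have hpow : ∀ i : ℕ, (h ^ i) v = v := by
    intro i
    induction i with
    | zero => rfl
    | succ i ih => rw [pow_succ, aut_mul_apply, D.h_v, ih]
  have hgw := aut_adj g D.adj
  rw [hv] at hgw
  obtain ⟨i, hi⟩ := D.h_trans _ hgw
  refine ⟨i, ?_⟩
  have k1 : ((h ^ i)⁻¹ * g) v = v := by rw [aut_mul_apply, hv, aut_inv_fix (hpow i)]
  have k2 : ((h ^ i)⁻¹ * g) w = w := by rw [aut_mul_apply, ← hi, aut_inv_apply_self]
  by_cases h1 : (h ^ i)⁻¹ * g = 1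
  · left
    exact (inv_mul_eq_one.1 h1).symm
  · right
    have := hG.flip_unique hc D.adj D.p_mem (mul_mem (inv_mem (pow_mem D.h_mem i)) hg) D.p_ne h1
      D.p_v D.p_w k1 k2
    rw [← this, mul_inv_cancel_left]

theorem isOfClass_two1 (D : EdgeData G σ v w h a p) (hG : IsSRegular X 2 G) (hc : IsCubic X)
    (hconn : X.Connected) : IsOfClass X G .two1 := by
  refine ⟨hG, ?_⟩
  let f : Fin 3 → G := ![⟨h, D.h_mem⟩, ⟨a, D.a_mem⟩, ⟨p, D.p_mem⟩]
  have hrel : ∀ r ∈ ArcClass.relators .two1, FreeGroup.lift f r = 1 := by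
    intro r hr
    have key : ∀ y : G, (y : X ≃g X) = 1 → y = 1 := fun y hy => Subtype.ext hy
    rcases hr with rfl | rfl | rfl | rfl | rfl <;> apply key <;>
      simp only [map_mul, map_pow, map_inv, FreeGroup.lift_apply_of, f, Matrix.cons_val,
        Subgroup.coe_mul, Subgroup.coe_pow, Subgroup.coe_inv]
    · exact D.h_pow
    · rw [pow_two, D.a_sq]
    · rw [pow_two, D.p_sq]
    · rw [D.ap, mul_assoc p, D.a_sq, mul_one, mul_inv_cancel]
    · rw [D.php, mul_inv_cancel]
  let φ : ArcClass.UnivGroup .two1 →* G := PresentedGroup.toGroup hrel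
  have h0 : φ (PresentedGroup.of (0 : Fin 3)) = ⟨h, D.h_mem⟩ := PresentedGroup.toGroup.of hrel
  have h1 : φ (PresentedGroup.of (1 : Fin 3)) = ⟨a, D.a_mem⟩ := PresentedGroup.toGroup.of hrel
  have h2 : φ (PresentedGroup.of (2 : Fin 3)) = ⟨p, D.p_mem⟩ := PresentedGroup.toGroup.of hrel
  have hT := hG.isTwoRegular
  refine ⟨φ, ?_, v, le_antisymm ?_ ?_, ?_⟩
  · rw [← MonoidHom.range_eq_top, eq_top_iff]
    have hmem : ∀ {y : X ≃g X} (hy : y ∈ G), (⟨y, hy⟩ : G) ∈ φ.range →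
        y ∈ φ.range.map G.subtype := fun hy h => ⟨_, h, rfl⟩
    have hle : G ≤ φ.range.map G.subtype := by
      have hh := hmem D.h_mem ⟨_, h0⟩
      have hp := hmem D.p_mem ⟨_, h2⟩
      refine le_of_stabilizer_le (Subgroup.map_subtype_le _)
        (D.transitive hconn hh (hmem D.a_mem ⟨_, h1⟩)) ?_
      intro g hg hgv
      obtain ⟨i, rfl | rfl⟩ := D.stabilizer_eq hT hc hg hgv
      · exact pow_mem hh i
      · exact mul_mem (pow_mem hh i) hp
    rintro ⟨g, hg⟩ -
    obtain ⟨y, hy, e⟩ := hle hg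
    have : y = ⟨g, hg⟩ := Subtype.ext e
    exact this ▸ hy
  · rw [ArcClass.vertexGroup, MonoidHom.map_closure, Subgroup.closure_le]
    rintro _ ⟨_, ⟨i, hi, rfl⟩, rfl⟩
    change Fin 3 at i
    fin_cases i
    · change φ (PresentedGroup.of (0 : Fin 3)) • v = v
      rw [h0]
      exact D.h_v
    · exact absurd rfl hi
    · change φ (PresentedGroup.of (2 : Fin 3)) • v = v
      rw [h2]
      exact D.p_v
  · rintro ⟨g, hg⟩ hgv
    have hm0 : (⟨h, D.h_mem⟩ : G) ∈ (ArcClass.vertexGroup .two1).map φ :=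
      ⟨_, Subgroup.subset_closure ⟨(0 : Fin 3), by decide, rfl⟩, h0⟩
    have hm2 : (⟨p, D.p_mem⟩ : G) ∈ (ArcClass.vertexGroup .two1).map φ :=
      ⟨_, Subgroup.subset_closure ⟨(2 : Fin 3), by decide, rfl⟩, h2⟩
    obtain ⟨i, hi | hi⟩ := D.stabilizer_eq hT hc hg hgv
    · have : (⟨g, hg⟩ : G) = ⟨h, D.h_mem⟩ ^ i := Subtype.ext hi
      rw [this]
      exact pow_mem hm0 i
    · have : (⟨g, hg⟩ : G) = ⟨h, D.h_mem⟩ ^ i * ⟨p, D.p_mem⟩ := Subtype.ext hi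
      rw [this]
      exact mul_mem (pow_mem hm0 i) hm2
  · change X.Adj v (φ (PresentedGroup.of (1 : Fin 3)) • v)
    rw [h1]
    change X.Adj v (a v)
    rw [D.a_v]
    exact D.adj

/-- An odd element carrying one arc to another becomes even after composing with the flip of the
first arc, and an even element fixing an arc is not a flip. -/
theorem isSRegular_one (D : EdgeData G σ v w h a p) (hG : IsTwoRegular X G) (hc : IsCubic X) :
    IsSRegular X 1 (G ⊓ σ.ker) where
  transitive f f' hf hf' := by
    have hf := isSArc_one_iff.1 hf
    have hf' := isSArc_one_iff.1 hf'
    obtain ⟨g, hg, e0, e1⟩ := hG.arc_trans hc hf hf'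
    rcases Int.units_eq_one_or (σ g) with hs | hs
    · refine ⟨g, ⟨hg, hs⟩, fun i => ?_⟩
      fin_cases i
      · exact e0
      · exact e1
    · obtain ⟨q, hq, q0, q1, hq1, -⟩ := hG.exists_flip hc hf
      have hqσ := hG.flip_sign hc σ D.adj hf D.p_mem hq D.p_ne hq1 D.p_v D.p_w q0 q1
      rw [D.p_odd] at hqσ
      refine ⟨g * q, ⟨mul_mem hg hq, ?_⟩, fun i => ?_⟩
      · change σ (g * q) = 1
        rw [map_mul, hs, hqσ]
        decide
      · fin_cases i
        · change (g * q) (f 0) = f' 0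
          rw [aut_mul_apply, q0, e0]
        · change (g * q) (f 1) = f' 1
          rw [aut_mul_apply, q1, e1]
  stabilizer_trivial f hf g hg hfix := by
    have hf := isSArc_one_iff.1 hf
    by_contra hg1
    have hqσ := hG.flip_sign hc σ D.adj hf D.p_mem hg.1 D.p_ne hg1 D.p_v D.p_w (hfix 0) (hfix 1)
    rw [D.p_odd, show σ g = 1 from hg.2] at hqσ
    exact absurd hqσ (by decide)

theorem isOfClass_one (D : EdgeData G σ v w h a p) (hG : IsTwoRegular X G) (hc : IsCubic X)
    (hconn : X.Connected) : IsOfClass X (G ⊓ σ.ker) .one := by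
  refine ⟨D.isSRegular_one hG hc, ?_⟩
  have hhm : h ∈ G ⊓ σ.ker := ⟨D.h_mem, D.h_even⟩
  have ham : a ∈ G ⊓ σ.ker := ⟨D.a_mem, D.a_even⟩
  have hstab : ∀ g ∈ G ⊓ σ.ker, g v = v → ∃ i : ℕ, g = h ^ i := by
    intro g hg hgv
    obtain ⟨i, rfl | rfl⟩ := D.stabilizer_eq hG hc hg.1 hgv
    · exact ⟨i, rfl⟩
    · have h1 : σ (h ^ i * p) = 1 := hg.2
      rw [map_mul, map_pow, D.h_even, D.p_odd, one_pow, one_mul] at h1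
      exact absurd h1 (by decide)
  generalize G ⊓ σ.ker = K at *
  let f : Fin 2 → K := ![⟨h, hhm⟩, ⟨a, ham⟩]
  have hrel : ∀ r ∈ ArcClass.relators .one, FreeGroup.lift f r = 1 := by
    intro r hr
    have key : ∀ y : K, (y : X ≃g X) = 1 → y = 1 := fun y hy => Subtype.ext hy
    rcases hr with rfl | rfl <;> apply key <;>
      simp only [map_pow, FreeGroup.lift_apply_of, f, Matrix.cons_val, Subgroup.coe_pow]
    · exact D.h_pow
    · rw [pow_two, D.a_sq]
  let φ : ArcClass.UnivGroup .one →* K := PresentedGroup.toGroup hrel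
  have h0 : φ (PresentedGroup.of (0 : Fin 2)) = ⟨h, hhm⟩ := PresentedGroup.toGroup.of hrel
  have h1 : φ (PresentedGroup.of (1 : Fin 2)) = ⟨a, ham⟩ := PresentedGroup.toGroup.of hrel
  refine ⟨φ, ?_, v, le_antisymm ?_ ?_, ?_⟩
  · rw [← MonoidHom.range_eq_top, eq_top_iff]
    have hmem : ∀ {y : X ≃g X} (hy : y ∈ K), (⟨y, hy⟩ : K) ∈ φ.range →
        y ∈ φ.range.map K.subtype := fun hy h => ⟨_, h, rfl⟩
    have hle : K ≤ φ.range.map K.subtype := by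
      have hh := hmem hhm ⟨_, h0⟩
      refine le_of_stabilizer_le (Subgroup.map_subtype_le _)
        (D.transitive hconn hh (hmem ham ⟨_, h1⟩)) ?_
      intro g hg hgv
      obtain ⟨i, rfl⟩ := hstab g hg hgv
      exact pow_mem hh i
    rintro ⟨g, hg⟩ -
    obtain ⟨y, hy, e⟩ := hle hg
    have : y = ⟨g, hg⟩ := Subtype.ext e
    exact this ▸ hy
  · rw [ArcClass.vertexGroup, MonoidHom.map_closure, Subgroup.closure_le]
    rintro _ ⟨_, ⟨i, hi, rfl⟩, rfl⟩
    change Fin 2 at i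
    fin_cases i
    · change φ (PresentedGroup.of (0 : Fin 2)) • v = v
      rw [h0]
      exact D.h_v
    · exact absurd rfl hi
  · rintro ⟨g, hg⟩ hgv
    have hm0 : (⟨h, hhm⟩ : K) ∈ (ArcClass.vertexGroup .one).map φ :=
      ⟨_, Subgroup.subset_closure ⟨(0 : Fin 2), by decide, rfl⟩, h0⟩
    obtain ⟨i, hi⟩ := hstab g hg hgv
    have : (⟨g, hg⟩ : K) = ⟨h, hhm⟩ ^ i := Subtype.ext hi
    rw [this]
    exact pow_mem hm0 i
  · change X.Adj v (φ (PresentedGroup.of (1 : Fin 2)) • v)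
    rw [h1]
    change X.Adj v (a v)
    rw [D.a_v]
    exact D.adj

/-- There is no subgroup of class `2²`, as there the involutions fixing an arc are squares, hence
even. -/
theorem not_isOfClass_two2 (D : EdgeData G σ v w h a p) (hG : IsTwoRegular X G) (hc : IsCubic X)
    {H : Subgroup (X ≃g X)} (hHG : H ≤ G) : ¬ IsOfClass X H .two2 := by
  rintro ⟨hH, φ, -, u, hu, -⟩
  have hT : IsTwoRegular X H := IsSRegular.isTwoRegular hH
  obtain ⟨x, hx, -⟩ := hc.exists_ne u u
  obtain ⟨q, hq, q0, q1, hq1, -⟩ := hT.exists_flip hc hx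
  have hqσ := hG.flip_sign hc σ D.adj hx D.p_mem (hHG hq) D.p_ne hq1 D.p_v D.p_w q0 q1
  rw [D.p_odd] at hqσ
  let ψ : ArcClass.UnivGroup .two2 →* ℤˣ := (σ.comp H.subtype).comp φ
  -- `h` has trivial cube and `p` is the square of `a`, so both have sign 1.
  have hle : ArcClass.vertexGroup .two2 ≤ ψ.ker := by
    rw [ArcClass.vertexGroup, Subgroup.closure_le]
    rintro _ ⟨i, hi, rfl⟩
    change Fin 3 at i
    fin_cases i
    · apply IsTwoRegular.eq_one_of_units_pow_three
      rw [← map_pow]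
      exact (congrArg ψ two2_h_pow).trans (map_one ψ)
    · exact absurd rfl hi
    · exact (congrArg ψ two2_a_sq).symm.trans ((map_pow ψ _ _).trans (Int.units_sq _))
  have hqu : (⟨q, hq⟩ : H) ∈ MulAction.stabilizer H u := q0
  rw [← hu] at hqu
  obtain ⟨y, hy, e⟩ := hqu
  have h1 : ψ y = 1 := hle hy
  change σ (φ y : X ≃g X) = 1 at h1
  rw [e] at h1
  change σ q = 1 at h1
  rw [h1] at hqσ
  exact absurd hqσ (by decide)

end EdgeData

/-- No subgroup of a `2`-regular group is transitive on `s`-arcs for `s ≥ 3`. -/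
theorem IsTwoRegular.not_isSRegular {G : Subgroup (X ≃g X)} (hG : IsTwoRegular X G)
    (hc : IsCubic X) [Nonempty V] {H : Subgroup (X ≃g X)} (hHG : H ≤ G) {s : ℕ} (hs : 3 ≤ s) :
    ¬ IsSRegular X s H := by
  intro hH
  obtain ⟨u⟩ := ‹Nonempty V›
  obtain ⟨a, b, c, hab, -, -, hn⟩ := hc.exists_neighbors u
  obtain ⟨f, hf, -⟩ := hc.exists_line ((hn a).2 (by simp)).symm ((hn b).2 (by simp)) hab
  -- Two `s`-arcs that agree up to index 2 and then part: an element carrying one to the other would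
  -- fix a 2-arc without being trivial.
  obtain ⟨w, w1, w2, w3⟩ := hc.exists_ne_ne (f (2 - 1)) (f 3) (f 2)
  obtain ⟨f', hf', k1, k2⟩ := hc.exists_line_modify hf 2 w1 w2
  have harc : ∀ f : ℤ → V, IsLine X f → IsSArc X s (fun i : Fin (s + 1) => f (i : ℕ)) :=
    fun f hf => ⟨fun i j h => hf.adj_of_eq (by omega), fun i j h => hf.ne_of_eq (by omega)⟩
  obtain ⟨g, hg, e⟩ := hH.transitive _ _ (harc f hf) (harc f' hf')
  have e' : ∀ i : ℕ, i ≤ s → g (f i) = f' i := fun i hi => e ⟨i, by omega⟩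
  have e0 := e' 0 (by omega)
  have e1 := e' 1 (by omega)
  have e2 := e' 2 (by omega)
  have e3 := e' 3 (by omega)
  rw [k1 _ (by norm_num)] at e0 e1 e2
  have : g = 1 := hG.trivial (hf.adj_of_eq (by norm_num)) (hf.adj_of_eq (by norm_num))
    (hf.ne_of_eq (by norm_num)) (hHG hg) e0 e1 e2
  rw [this] at e3
  apply w3
  rw [← k2]
  exact e3.symm

theorem EdgeData.isOfType {G : Subgroup (X ≃g X)} {σ : (X ≃g X) →* ℤˣ} {v w : V} {h a p : X ≃g X}
    (D : EdgeData G σ v w h a p) (hG : IsSRegular X 2 G) (hc : IsCubic X) (hconn : X.Connected)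
    (htop : G = ⊤) : IsOfType X {.one, .two1} where
  aut := ⟨.two1, by simp, htop ▸ D.isOfClass_two1 hG hc hconn⟩
  classes c := by
    have hT := hG.isTwoRegular
    have := hconn.nonempty
    have hle : ∀ H : Subgroup (X ≃g X), H ≤ G := fun H => htop ▸ le_top
    constructor
    · rintro (rfl | rfl)
      · exact ⟨_, D.isOfClass_one hT hc hconn⟩
      · exact ⟨_, D.isOfClass_two1 hG hc hconn⟩
    · rintro ⟨H, hH⟩
      cases c
      · simp
      · simp
      · exact absurd hH (D.not_isOfClass_two2 hT hc (hle H))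
      · exact absurd hH.1 (hT.not_isSRegular hc (hle H) (by decide))
      · exact absurd hH.1 (hT.not_isSRegular hc (hle H) (by decide))
      · exact absurd hH.1 (hT.not_isSRegular hc (hle H) (by decide))
      · exact absurd hH.1 (hT.not_isSRegular hc (hle H) (by decide))

end Classes

/-! ### From an odd element to odd flips and odd cycles -/

section Parity

variable {V : Type*} [Fintype V] [DecidableEq V] {X : SimpleGraph V}

/-- In a `2`-regular quotient of `G₂¹` with odd elements, the involutions fixing arcs are odd. -/
theorem IsTwoRegular.odd_of_fix_arc {G : Subgroup (X ≃g X)} (hG : IsTwoRegular X G)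
    (hc : IsCubic X) (h4 : 4 ∣ Fintype.card V) {φ : ArcClass.UnivGroup .two1 →* G}
    (hφ : Function.Surjective φ) {g : X ≃g X} (hg : g ∈ G) (hodd : autSign X g = -1) {u v : V}
    (h : X.Adj u v) {p : X ≃g X} (hp : p ∈ G) (hp1 : p ≠ 1) (hpu : p u = u) (hpv : p v = v) :
    autSign X p = -1 := by
  by_contra hcon
  have heven := (Int.units_eq_one_or _).resolve_right hcon
  -- all involutions of `G` are even
  have hinv : ∀ t ∈ G, t * t = 1 → autSign X t = 1 := by
    intro t ht ht2
    by_cases hex : ∃ w, t w = w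
    · obtain ⟨w, hw⟩ := hex
      exact hG.even_of_fix_vertex hc _ h hp hp1 hpu hpv heven ht hw
    · push Not at hex
      exact even_of_fixedPointFree ht2 hex h4
  let ψ : ArcClass.UnivGroup .two1 →* ℤˣ := ((autSign X).comp G.subtype).comp φ
  -- The sign vanishes on each generator: one has trivial cube, the other two have trivial square.
  have hψ : ψ = 1 := by
    have key : ∀ y : ArcClass.UnivGroup .two1, y ^ 2 = 1 → ψ y = 1 := by
      intro y hy
      refine hinv (φ y) (φ y).2 ?_
      rw [← Subgroup.coe_mul, ← map_mul, ← pow_two, hy, map_one]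
      rfl
    apply PresentedGroup.ext
    intro i
    change Fin 3 at i
    fin_cases i
    · apply IsTwoRegular.eq_one_of_units_pow_three
      rw [← map_pow]
      exact (congrArg ψ two1_h_pow).trans (map_one ψ)
    · exact key _ two1_a_sq
    · exact key _ two1_p_sq
  obtain ⟨y, hy⟩ := hφ ⟨g, hg⟩
  have h1 : ψ y = 1 := by rw [hψ]; rfl
  change autSign X (φ y : X ≃g X) = 1 at h1
  rw [hy] at h1
  rw [show autSign X g = 1 from h1] at hodd
  exact absurd hodd (by decide)

/-- `a * p` is an odd involution reversing an edge. In a bipartite graph it would exchange the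
colour classes and so be fixed-point-free and even. -/
theorem EdgeData.not_isBipartite {G : Subgroup (X ≃g X)} {v w : V} {h a p : X ≃g X}
    (D : EdgeData G (autSign X) v w h a p) (hconn : X.Connected) (h4 : 4 ∣ Fintype.card V) :
    ¬ X.IsBipartite := by
  rintro ⟨C⟩
  -- an automorphism swapping the ends of an edge moves every vertex
  have key : ∀ t : X ≃g X, t v = w → ∀ u, t u ≠ u := by
    intro t ht u hu
    obtain ⟨q⟩ := hconn.preconnected v u
    have h0 : C (t v) ≠ C v := by
      rw [ht]
      exact (C.valid D.adj).symm
    have : ∀ x, X.Walk x u → C (t x) ≠ C x → C (t u) ≠ C u := by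
      intro x q h0
      induction q with
      | nil => exact h0
      | cons hadj q ih =>
        apply ih hu q
        have e1 := C.valid hadj
        have e2 := C.valid (aut_adj t hadj)
        omega
    exact this v q h0 (by rw [hu])
  have h1 := even_of_fixedPointFree (g := a * p) (by
    calc a * p * (a * p) = a * p * (p * a) := by rw [D.ap]
      _ = a * (p * p) * a := by group
      _ = 1 := by rw [D.p_sq, mul_one, D.a_sq]) (key _ (by rw [aut_mul_apply, D.p_v, D.a_v])) h4
  rw [map_mul, D.a_even, D.p_odd] at h1
  exact absurd h1 (by decide)

end Parity

/-! ### Group orders, the element of order `2 ^ k`, and the Cayley structure -/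

section Cayley

variable {V : Type*} {X : SimpleGraph V}

theorem natCard_eq_two_of_forall {A : Type*} [Group A] {S : Subgroup A} {p : A} (hp : p ∈ S)
    (hp1 : p ≠ 1) (h : ∀ y ∈ S, y = 1 ∨ y = p) : Nat.card S = 2 := by
  rw [Nat.card_eq_two_iff]
  refine ⟨1, ⟨p, hp⟩, fun e => hp1 (congrArg Subtype.val e).symm, ?_⟩
  ext ⟨y, hy⟩
  simp only [Set.mem_insert_iff, Set.mem_singleton_iff, Set.mem_univ, iff_true]
  rcases h y hy with h | h
  · exact Or.inl (Subtype.ext h)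
  · exact Or.inr (Subtype.ext h)

/-- The order of a `2`-regular group. -/
theorem IsTwoRegular.natCard {G : Subgroup (X ≃g X)} (hG : IsTwoRegular X G) (hc : IsCubic X)
    {v w : V} (h : X.Adj v w) : Nat.card G = Nat.card V * 6 := by
  obtain ⟨p, hp, hpv, hpw, hp1, -⟩ := hG.exists_flip hc h
  let S := MulAction.stabilizer G v
  have h1 : Nat.card (MulAction.stabilizer S w) = 2 := by
    refine natCard_eq_two_of_forall (p := ⟨⟨p, hp⟩, hpv⟩) hpw
      (fun e => hp1 (congrArg (fun y : S => ((y : G) : X ≃g X)) e)) ?_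
    rintro ⟨⟨y, hy⟩, hyv⟩ hyw
    by_cases hy1 : y = 1
    · left
      exact Subtype.ext (Subtype.ext hy1)
    · right
      exact Subtype.ext (Subtype.ext (hG.flip_unique hc h hp hy hp1 hy1 hpv hpw hyv hyw))
  have h2 : MulAction.orbit S w = X.neighborSet v := by
    ext u
    constructor
    · rintro ⟨⟨⟨y, hy⟩, hyv⟩, rfl⟩
      have := aut_adj y h
      rw [show y v = v from hyv] at this
      exact this
    · intro hu
      obtain ⟨g, hg, e1, e2⟩ := hG.arc_trans hc h hu
      exact ⟨⟨⟨g, hg⟩, e1⟩, e2⟩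
  have h3 : Nat.card S = 6 := by
    rw [← Subgroup.card_mul_index (MulAction.stabilizer S w), h1, MulAction.index_stabilizer, h2,
      hc v]
  have h4 : MulAction.orbit G v = Set.univ := by
    rw [Set.eq_univ_iff_forall]
    intro u
    obtain ⟨x, hx, -⟩ := hc.exists_ne u u
    obtain ⟨g, hg, e1, -⟩ := hG.arc_trans hc h hx
    exact ⟨⟨g, hg⟩, e1⟩
  rw [← Subgroup.card_mul_index S, h3, MulAction.index_stabilizer, h4, Set.ncard_univ, mul_comm]

/-- The order of the centralizer of an involution fixing an arc. -/
theorem IsTwoRegular.natCard_centralizer {G : Subgroup (X ≃g X)} (hG : IsTwoRegular X G)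
    (hc : IsCubic X) {v w : V} (h : X.Adj v w) {p : X ≃g X} (hp : p ∈ G) (hp1 : p ≠ 1)
    (hpv : p v = v) (hpw : p w = w) (hpp : p * p = 1) :
    Nat.card (G ⊓ Subgroup.centralizer {p} : Subgroup (X ≃g X)) =
      2 * {u | p u = u}.ncard := by
  have hmem : ∀ g : X ≃g X, g ∈ G ⊓ Subgroup.centralizer {p} ↔ g ∈ G ∧ g * p = p * g :=
    fun g => by rw [Subgroup.mem_inf, Subgroup.mem_centralizer_singleton_iff]
  generalize G ⊓ Subgroup.centralizer {p} = C at *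
  have h1 : Nat.card (MulAction.stabilizer C v) = 2 := by
    refine natCard_eq_two_of_forall (p := ⟨p, (hmem p).2 ⟨hp, rfl⟩⟩) hpv
      (fun e => hp1 (congrArg Subtype.val e)) ?_
    rintro ⟨y, hy⟩ hyv
    obtain ⟨hyG, hyp⟩ := (hmem y).1 hy
    have hyv : y v = v := hyv
    -- `w` is the only neighbour of `v` fixed by `p`
    have hyw : y w = w := by
      by_contra hne
      have k1 := aut_adj y h
      rw [hyv] at k1
      refine hG.moves_of_ne_one h.symm k1 (Ne.symm hne) hp hp1 hpw hpv ?_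
      rw [← aut_mul_apply, ← hyp, aut_mul_apply, hpw]
    by_cases hy1 : y = 1
    · left
      exact Subtype.ext hy1
    · right
      exact Subtype.ext (hG.flip_unique hc h hp hyG hp1 hy1 hpv hpw hyv hyw)
  have h2 : MulAction.orbit C v = {u | p u = u} := by
    ext u
    constructor
    · rintro ⟨⟨y, hy⟩, rfl⟩
      change p (y v) = y v
      rw [← aut_mul_apply, ← ((hmem y).1 hy).2, aut_mul_apply, hpv]
    · intro hu
      -- `p` flips an arc at each vertex that it fixes; an element of `G` taking `(v, w)` to that
      -- arc conjugates `p` to itself.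
      rcases hG.fix_vertex hc hp hu with ⟨x, hx, hpx⟩ | h3
      · obtain ⟨g, hg, e1, e2⟩ := hG.arc_trans hc h hx
        have := hG.flip_conj hc hx hp hp hp1 hp1 hpv hpw hu hpx hg e1 e2
        exact ⟨⟨g, (hmem g).2 ⟨hg, mul_inv_eq_iff_eq_mul.1 this⟩⟩, e1⟩
      · rw [pow_succ, pow_two, hpp, one_mul] at h3
        exact absurd h3 hp1
  rw [← Subgroup.card_mul_index (MulAction.stabilizer C v), h1, MulAction.index_stabilizer, h2]

/-- A nontrivial power of `c` with a fixed vertex would make the involution `t` of `⟨c⟩` a flip,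
hence odd; but `t` is a square, as `4 ∣ 2 ^ k`. -/
theorem IsTwoRegular.regular_of_orderOf {G : Subgroup (X ≃g X)} (hG : IsTwoRegular X G)
    (hc : IsCubic X) (σ : (X ≃g X) →* ℤˣ) {v w : V} (h : X.Adj v w) {p : X ≃g X} (hp : p ∈ G)
    (hp1 : p ≠ 1) (hpv : p v = v) (hpw : p w = w) (hσ : σ p = -1) {k : ℕ} (hk : 2 ≤ k)
    {c : X ≃g X} (hcG : c ∈ G) (hord : orderOf c = 2 ^ k) (i : ℕ) (u : V) (hu : (c ^ i) u = u) :
    c ^ i = 1 := by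
  by_contra hne
  -- the involution in the group generated by `c ^ i` is a square
  have hd : orderOf (c ^ i) ∣ 2 ^ k := hord ▸ orderOf_pow_dvd i
  obtain ⟨j, -, hj⟩ := (Nat.dvd_prime_pow Nat.prime_two).1 hd
  have hj0 : j ≠ 0 := by
    rintro rfl
    exact hne (orderOf_eq_one_iff.1 hj)
  obtain ⟨j, rfl⟩ := Nat.exists_eq_succ_of_ne_zero hj0
  obtain ⟨t, ht⟩ : ∃ t, t = (c ^ i) ^ 2 ^ j := ⟨_, rfl⟩
  have ht1 : t ≠ 1 := by
    intro e
    have h2 := Nat.le_of_dvd (by positivity) (orderOf_dvd_of_pow_eq_one (ht ▸ e))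
    rw [hj] at h2
    exact absurd h2 (not_le.2 (Nat.pow_lt_pow_right (by norm_num) (by omega)))
  have htt : t * t = 1 := by
    rw [ht, ← pow_two, ← pow_mul, ← pow_succ]
    exact hj ▸ pow_orderOf_eq_one _
  have htu : t u = u := by
    rw [ht]
    generalize 2 ^ j = n
    induction n with
    | zero => rfl
    | succ n ih => rw [pow_succ, aut_mul_apply, hu, ih]
  have htσ : σ t = 1 := by
    have h3 : c ^ (2 * (i * 2 ^ j)) = 1 := by
      rw [mul_comm, pow_mul, pow_mul, ← ht, pow_two, htt]
    have h4 := orderOf_dvd_of_pow_eq_one h3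
    rw [hord, show 2 ^ k = 2 * 2 ^ (k - 1) by rw [← pow_succ']; congr 1; omega] at h4
    obtain ⟨r, hr⟩ : 2 ∣ i * 2 ^ j :=
      (dvd_pow_self 2 (by omega)).trans (Nat.dvd_of_mul_dvd_mul_left (by norm_num) h4)
    rw [ht, ← pow_mul, hr, map_pow, pow_mul, Int.units_sq, one_pow]
  have htG : t ∈ G := ht ▸ pow_mem (pow_mem hcG i) _
  rcases hG.fix_vertex hc htG htu with ⟨x, hx, htx⟩ | h3
  · rw [hG.flip_sign hc σ h hx hp htG hp1 ht1 hpv hpw htu htx, hσ] at htσ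
    exact absurd htσ (by decide)
  · rw [pow_succ, pow_two, htt, one_mul] at h3
    exact ht1 h3

/-- The type of the graph determines the order of its automorphism group. -/
theorem IsTwoRegular.eq_top_of_isOfType {G : Subgroup (X ≃g X)} (hG : IsTwoRegular X G)
    (hc : IsCubic X) {u v : V} (h : X.Adj u v) (hT : IsOfType X {.one, .two1}) : G = ⊤ := by
  obtain ⟨c, hcm, hcl, -⟩ := hT.aut
  rcases hcm with rfl | rfl
  · exfalso
    -- The flip in `G` contradicts 1-regularity of the full group.
    obtain ⟨p, hp, hpu, hpv, hp1, -⟩ := hG.exists_flip hc h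
    refine hp1 (hcl.stabilizer_trivial ![u, v] (isSArc_one_iff.2 h) p
      (Subgroup.mem_top p) fun i => ?_)
    change Fin 2 at i
    fin_cases i
    · exact hpu
    · exact hpv
  · have hcl : IsTwoRegular X ⊤ := IsSRegular.isTwoRegular hcl
    rw [eq_top_iff]
    intro g _
    obtain ⟨w, h1, h2⟩ := hc.exists_ne u v
    obtain ⟨g', hg', e1, e2, e3⟩ := hG.trans h h1 h2.symm (aut_adj g h) (aut_adj g h1)
      (aut_ne h2.symm)
    have : g'⁻¹ * g = 1 := hcl.trivial h h1 h2.symm (Subgroup.mem_top _)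
      (by rw [aut_mul_apply, ← e1, aut_inv_apply_self])
      (by rw [aut_mul_apply, ← e2, aut_inv_apply_self])
      (by rw [aut_mul_apply, ← e3, aut_inv_apply_self])
    rw [← inv_mul_eq_one.1 this]
    exact hg'

/-- A semiregular cyclic group of automorphisms makes the graph an `m`-Cayley graph. -/
theorem isMCayley_of_semiregular [Fintype V] {d m : ℕ} [NeZero d] (hcard : Fintype.card V = d * m)
    {c : X ≃g X} (hord : orderOf c = d) (hreg : ∀ (i : ℕ) u, (c ^ i) u = u → c ^ i = 1) :
    IsMCayley X m (Multiplicative (ZMod d)) := by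
  have : Finite (X ≃g X) := Finite.of_injective _ RelIso.toEquiv_injective
  have hd : 0 < d := Nat.pos_of_ne_zero (NeZero.ne d)
  let H := Subgroup.zpowers c
  have hH : Nat.card H = d := by rw [Nat.card_zpowers, hord]
  have hZ : Nat.card (Multiplicative (ZMod d)) = d := by
    rw [Nat.card_congr Multiplicative.toAdd, Nat.card_zmod]
  have hstab : ∀ v : V, MulAction.stabilizer H v = ⊥ := by
    intro v
    rw [eq_bot_iff]
    rintro ⟨y, hy⟩ hyv
    obtain ⟨i, rfl⟩ := (isOfFinOrder_of_finite c).mem_powers_iff_mem_zpowers.2 hy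
    exact Subtype.ext (hreg i v hyv)
  have horb : ∀ v : V, (MulAction.orbit H v).ncard = d := by
    intro v
    rw [← MulAction.index_stabilizer, hstab, Subgroup.index_bot, hH]
  refine ⟨H, ⟨?_, fun v => by rw [horb, hZ], hstab⟩, ⟨mulEquivOfCyclicCardEq (by rw [hH, hZ])⟩⟩
  have : Fintype (MulAction.orbitRel.Quotient H V) := Fintype.ofFinite _
  have h1 := Nat.card_congr (MulAction.selfEquivSigmaOrbitsQuotientStabilizer H V)
  have h2 : ∀ v : V, Nat.card (H ⧸ MulAction.stabilizer H v) = d := fun v => by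
    rw [hstab v]
    have := Subgroup.index_bot (G := H)
    rw [hH] at this
    exact this
  rw [Nat.card_sigma, Nat.card_eq_fintype_card, hcard, Finset.sum_congr rfl fun ω _ => h2 _,
    Finset.sum_const, smul_eq_mul, Finset.card_univ, mul_comm] at h1
  rw [Nat.card_eq_fintype_card]
  exact (Nat.eq_of_mul_eq_mul_right hd h1).symm

variable [Fintype V] [DecidableEq V]

/-- If the involutions fixing arcs are odd, there is an element of order `2 ^ k`. -/
theorem IsTwoRegular.exists_orderOf {G : Subgroup (X ≃g X)} (hG : IsTwoRegular X G)
    (hc : IsCubic X) {k m : ℕ} (hk : 2 ≤ k) (hm : Odd m) (hcard : Fintype.card V = 2 ^ k * m)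
    {v w : V} (h : X.Adj v w) {p : X ≃g X} (hp : p ∈ G) (hp1 : p ≠ 1) (hpv : p v = v)
    (hpw : p w = w) (hpp : p * p = 1) (hσ : autSign X p = -1) :
    ∃ c ∈ G, orderOf c = 2 ^ k := by
  have : Finite (X ≃g X) := Finite.of_injective _ RelIso.toEquiv_injective
  have : Fact (Nat.Prime 2) := ⟨Nat.prime_two⟩
  have hGcard : Nat.card G = 2 ^ (k + 1) * (3 * m) := by
    rw [hG.natCard hc h, Nat.card_eq_fintype_card, hcard]
    ring
  -- The centralizer has order `2 * |Fix p|`, and `|Fix p| = |V| - 2 * r` with `r` odd and `4 ∣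
  -- |V|`.
  have hC : Nat.card (G ⊓ Subgroup.centralizer {p} : Subgroup (X ≃g X)) % 8 = 4 := by
    rw [hG.natCard_centralizer hc h hp hp1 hpv hpw hpp]
    obtain ⟨r, h1, h2⟩ := exists_sign_involution hpp
    rw [hσ] at h2
    have hr : ¬ Even r := fun he => by
      rw [he.neg_one_pow] at h2
      exact absurd h2 (by decide)
    rw [Nat.even_iff] at hr
    have h3 : {u | p u = u}.ncard = Fintype.card {u // p u = u} := by
      rw [← Nat.card_coe_set_eq, ← Nat.card_eq_fintype_card]
      rfl
    have h4 : 4 ∣ Fintype.card V := by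
      rw [hcard]
      exact ((by norm_num : 4 ∣ 2 ^ 2).trans (pow_dvd_pow 2 hk)).mul_right m
    omega
  let pG : G := ⟨p, hp⟩
  have hpG : IsPGroup 2 (Subgroup.zpowers pG) := by
    have hz : (pG : G) ^ 2 ^ 1 = 1 := Subtype.ext (by
      rw [Subgroup.coe_pow]
      simpa [pow_two] using hpp)
    obtain ⟨j, -, hj⟩ := (Nat.dvd_prime_pow Nat.prime_two).1 (orderOf_dvd_of_pow_eq_one hz)
    exact IsPGroup.of_card (n := j) (by rw [Nat.card_zpowers, hj])
  obtain ⟨Q, hQ⟩ := hpG.exists_le_sylow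
  have hpQ : pG ∈ (Q : Subgroup G) := hQ (Subgroup.mem_zpowers pG)
  have hQcard : Nat.card (Q : Subgroup G) = 2 ^ (k + 1) := by
    obtain ⟨e, he⟩ := IsPGroup.iff_card.1 Q.isPGroup'
    have h1 := Subgroup.card_mul_index (Q : Subgroup G)
    rw [hGcard] at h1
    have h2 : Nat.Coprime (2 ^ (k + 1)) (Q : Subgroup G).index :=
      Nat.Coprime.pow_left _ ((Nat.Prime.coprime_iff_not_dvd Nat.prime_two).2 Q.not_dvd_index)
    have h3 : Nat.Coprime (Nat.card (Q : Subgroup G)) (3 * m) := by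
      rw [he]
      exact Nat.Coprime.pow_left _ (Nat.Coprime.mul_right (by norm_num)
        (Nat.coprime_two_left.2 hm))
    refine Nat.dvd_antisymm ?_ ?_
    · exact h3.dvd_of_dvd_mul_right (h1 ▸ Dvd.intro _ rfl)
    · exact h2.dvd_of_dvd_mul_right (h1 ▸ Dvd.intro _ rfl)
  let pQ : (Q : Subgroup G) := ⟨pG, hpQ⟩
  have hcent : Nat.card (Subgroup.centralizer {pQ}) ≤ 4 := by
    let ι : (Q : Subgroup G) →* (X ≃g X) := G.subtype.comp (Q : Subgroup G).subtype
    have hι : Function.Injective ι :=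
      (Subgroup.subtype_injective G).comp (Subgroup.subtype_injective _)
    have h1 : (Subgroup.centralizer {pQ}).map ι ≤ G ⊓ Subgroup.centralizer {p} := by
      rintro _ ⟨y, hy, rfl⟩
      refine ⟨(y : G).2, ?_⟩
      have hy' := congrArg ι (Subgroup.mem_centralizer_singleton_iff.1 hy)
      exact Subgroup.mem_centralizer_singleton_iff.2 hy'
    have h2 := Subgroup.card_dvd_of_le h1
    rw [Subgroup.card_map_of_injective hι] at h2
    obtain ⟨j, -, hj⟩ := (Nat.dvd_prime_pow Nat.prime_two).1
      (hQcard ▸ Subgroup.card_subgroup_dvd_card (Subgroup.centralizer {pQ}))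
    -- A power of 2 dividing a number that is `4 mod 8` is at most 4.
    rw [hj] at h2 ⊢
    by_contra hlt
    have hj3 : 3 ≤ j := by
      by_contra h3
      have : 2 ^ j ≤ 2 ^ 2 := Nat.pow_le_pow_right (by norm_num) (by omega)
      omega
    have h8 : 8 ∣ 2 ^ j := (by norm_num : 8 ∣ 2 ^ 3).trans (pow_dvd_pow 2 hj3)
    have := h8.trans h2
    omega
  obtain ⟨c, hcord⟩ := exists_orderOf_eq_of_card_centralizer_le k hk (Q : Subgroup G) hQcard pQ
    (Subtype.ext (Subtype.ext hpp))
    (fun e => hp1 (congrArg (fun y : (Q : Subgroup G) => ((y : G) : X ≃g X)) e)) hcent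
  exact ⟨((c : G) : X ≃g X), (c : G).2, by rw [Subgroup.orderOf_coe, Subgroup.orderOf_coe, hcord]⟩

/-- A generator of a semiregular cyclic `2`-group with an odd number of orbits is odd. -/
theorem IsMCayley.exists_odd {k m : ℕ} (hk : k ≠ 0) (hm : Odd m)
    (hcard : Fintype.card V = 2 ^ k * m)
    (h : IsMCayley X m (Multiplicative (ZMod (2 ^ k)))) : ∃ g : X ≃g X, autSign X g = -1 := by
  obtain ⟨H, hH, ⟨e⟩⟩ := h
  let c : H := e.symm (Multiplicative.ofAdd 1)
  have hord : orderOf (c : X ≃g X) = 2 ^ k := by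
    rw [Subgroup.orderOf_coe, MulEquiv.orderOf_eq, orderOf_ofAdd_eq_addOrderOf,
      ZMod.addOrderOf_one]
  refine ⟨c, odd_of_semiregular (even_two.pow_of_ne_zero hk) hm hcard hord ?_ ?_⟩
  · intro h1
    rw [h1, orderOf_one] at hord
    exact absurd hord.symm (Nat.one_lt_two_pow hk).ne'
  · intro i v hv
    have h1 : c ^ i ∈ MulAction.stabilizer H v := hv
    rw [hH.regular, Subgroup.mem_bot] at h1
    exact congrArg Subtype.val h1

end Cayley

end CubicSym

/-! ### The equivalence -/

theorem proposition4p7 {V : Type*} [Fintype V] [DecidableEq V] (X : SimpleGraph V)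
    (hX : CubicSym.IsCubicSymmetric X) (k m : ℕ) (hk : 2 ≤ k) (hm : Odd m)
    (hcard : Fintype.card V = 2 ^ k * m)
    (G : Subgroup (X ≃g X)) (hG : CubicSym.IsSRegular X 2 G)
    (hG21 : ∃ φ : CubicSym.ArcClass.UnivGroup .two1 →* G, Function.Surjective φ) :
    (∃ g ∈ G, CubicSym.IsOddAut g) ↔
      ¬ X.IsBipartite ∧ CubicSym.IsOfType X {.one, .two1} ∧
        CubicSym.IsMCayley X m (Multiplicative (ZMod (2 ^ k))) := by
  have hc : CubicSym.IsCubic X := hX.cubic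
  have hconn := hX.connected
  have hT := hG.isTwoRegular
  obtain ⟨v⟩ := hconn.nonempty
  obtain ⟨w, hvw, -⟩ := hc.exists_ne v v
  constructor
  · rintro ⟨g, hg, hodd⟩
    obtain ⟨φ, hφ⟩ := hG21
    have h4 : 4 ∣ Fintype.card V := by
      rw [hcard]
      exact ((by norm_num : 4 ∣ 2 ^ 2).trans (pow_dvd_pow 2 hk)).mul_right m
    obtain ⟨p, hp, hpv, hpw, hp1, hpp⟩ := hT.exists_flip hc hvw
    have hpσ := hT.odd_of_fix_arc hc h4 hφ hg hodd hvw hp hp1 hpv hpw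
    obtain ⟨h, a, D⟩ := hT.exists_edgeData hc (CubicSym.autSign X) hvw hp hp1 hpv hpw hpσ
    refine ⟨D.not_isBipartite hconn h4, D.isOfType hG hc hconn
      (hT.eq_top_of_odd hc hconn _ hvw hp hp1 hpv hpw hpσ), ?_⟩
    obtain ⟨c, hcG, hord⟩ := hT.exists_orderOf hc hk hm hcard hvw hp hp1 hpv hpw hpp hpσ
    exact CubicSym.isMCayley_of_semiregular hcard hord
      (hT.regular_of_orderOf hc _ hvw hp hp1 hpv hpw hpσ hk hcG hord)
  · rintro ⟨-, htype, hcay⟩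
    obtain ⟨g, hg⟩ := hcay.exists_odd (by omega) hm hcard
    rw [hT.eq_top_of_isOfType hc hvw htype]
    exact ⟨g, Subgroup.mem_top g, hg⟩
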